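/- Let $d\ge 2$, let $\mathbb T^d=\mathbb R^d/\mathbb Z^d$, $\mathbb Z^d_0=\mathbb Z^d\setminus\{0\}$, $e_k(x)=e^{2\pi i k\cdot x}$, and let $\kappa,\nu,\delta>0$. Let $\theta=(\theta_k)_{k\in\mathbb Z^d_0}$ be real with $\theta_k=\theta_l$ whenever $|k|=|l|$ and $\sum_k\theta_k^2=1$; write $\|\theta\|_{\ell^\infty}=\sup_k|\theta_k|$. For $k\in\mathbb Z^d_0$ let $\{a_{k,i}\}_{i=1}^{d-1}$ be an orthonormal basis of $k^\perp\subset\mathbb R^d$ with $a_{-k,i}=a_{k,i}$, and put $\sigma_{k,i}=a_{k,i}e_k$. On a filtered probability space $(\Omega,\mathcal F,(\mathcal F_t)_{t\ge0},\mathbb P)$ let $W^{k,i}$ ($k\in\mathbb Z^d_0$, $1\le i\le d-1$) be standard complex $(\mathcal F_t)$-Brownian motions that are independent up to the constraint $\overline{W^{k,i}}=W^{-k,i}$, so that $[W^{k,i},W^{l,j}]_t=2t\,\delta_{k,-l}\delta_{i,j}$. Let $\Pi$ be the Helmholtz projection, $\Pi X=\sum_{l\in\mathbb Z_0^d}\big(I_d-\frac{l\otimes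 l}{|l|^2}\big)X_l e_l$ for $X=\sum_l X_l e_l$. Let $(f_t)_{t\ge0}$ be a progressively measurable process with values in the mean-zero vector fields of $L^2(\mathbb T^d,\mathbb R^d)$ such that, almost surely, $$\|f_t\|_{L^2}^2+\nu\int_s^t\|\nabla f_r\|_{L^2}^2\,dr\le\|f_s\|_{L^2}^2\qquad\text{for all } t>s\ge0,$$ where $\|\nabla u\|_{L^2}=\infty$ if $u\notin H^1$. For $0\le s\le t$ let $$Z_{s,t}=\sqrt{\tfrac{d}{d-1}\,\kappa}\;\sum_{k\in\mathbb Z^d_0}\sum_{i=1}^{d-1}\theta_k\int_s^t e^{\delta(t-r)\Delta}\,\Pi(\sigma_{k,i}\cdot\nabla f_r)\,dW^{k,i}_r$$ (Itô integrals of $L^2$-valued processes, the series converging in $L^2(\Omega;L^2)$). Then for all $\alpha,\beta$ with $0<\alpha<1\le\frac d2<\beta$ there is a constant $C>0$ depending only on $\alpha$ and $\beta$ such that, for every $n\ge0$, $$\int_n^{n+1}\mathbb E\|Z_{n,t}\|_{L^2}^2\,dt\le C\,\kappa\,\nu^{-\frac{\beta}{\alpha+\beta}}\,\delta^{-\frac{\alpha(2\beta+d+4)}{4(\alpha+\beta)}}\,\|\theta\|_{\ell^\infty}^{\frac{2\alpha}{\alpha+\beta}}\,\mathbb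 E\|f_n\|_{L^2}^2 .$$ -/

import Mathlib

open MeasureTheory ProbabilityTheory Filter Topology
open scoped NNReal ENNReal ComplexConjugate

noncomputable section

namespace TransportNoise

/-! ### Vector fields on the torus and Fourier analysis -/

/-- The normalised Haar measure (total mass one) on the torus `𝕋ᵈ = ℝᵈ / ℤᵈ`. -/
abbrev torusMeasure (d : ℕ) : Measure (UnitAddTorus (Fin d)) :=
  Measure.pi fun _ => AddCircle.haarAddCircle

/-- The Hilbert space `L²(𝕋ᵈ, ℂ)`. -/
abbrev ScalarField (d : ℕ) : Type := Lp ℂ 2 (torusMeasure d)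

/-- The Hilbert space `L²(𝕋ᵈ, ℂᵈ)` of square integrable vector fields, as `d`-tuples of scalar
fields with `‖u‖² = ∑ⱼ ‖uⱼ‖²`. -/
abbrev VectorField (d : ℕ) : Type := PiLp 2 fun _ : Fin d => ScalarField d

/-- The nonzero frequencies `ℤᵈ \ {0}`. -/
abbrev NonzeroFreq (d : ℕ) : Type := {k : Fin d → ℤ // k ≠ 0}

/-- The frequency `-k`. -/
def negFreq {d : ℕ} (k : NonzeroFreq d) : NonzeroFreq d := ⟨-k.1, neg_ne_zero.2 k.2⟩

/-- The squared Euclidean length `|k|²` of a frequency. -/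
def freqSq {d : ℕ} (k : Fin d → ℤ) : ℝ := ∑ j, (k j : ℝ) ^ 2

/-- The basis element `e_k(x) = exp (2πi k·x)` of `L²(𝕋ᵈ, ℂ)`. -/
def basisFun {d : ℕ} (k : Fin d → ℤ) : ScalarField d :=
  ContinuousMap.toLp (E := ℂ) 2 (torusMeasure d) ℂ (UnitAddTorus.mFourier k)

/-- The `k`-th Fourier coefficient `⟨u, e_k⟩ = ∫ u(x) exp (-2πi k·x) dx`. -/
def fourierCoef {d : ℕ} (u : ScalarField d) (k : Fin d → ℤ) : ℂ :=
  ∫ x, UnitAddTorus.mFourier (-k) x * u x ∂(torusMeasure d)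

/-- The vector field is `ℝᵈ`-valued. -/
def IsRealField {d : ℕ} (u : VectorField d) : Prop :=
  ∀ j, ∀ᵐ x ∂(torusMeasure d), (u j x).im = 0

/-- The vector field has zero average. -/
def HasZeroMean {d : ℕ} (u : VectorField d) : Prop :=
  ∀ j, ∫ x, u j x ∂(torusMeasure d) = 0

/-- `‖∇u‖²_{L²} = ∑ⱼ ∑ₗ 4π²|l|² |⟨uⱼ, e_l⟩|²`, which is `∞` when `u` is not in `H¹`. -/
def gradNormSq {d : ℕ} (u : VectorField d) : ℝ≥0∞ :=
  ∑ j, ∑' l : Fin d → ℤ,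
    ENNReal.ofReal (4 * Real.pi ^ 2 * freqSq l) * ‖fourierCoef (u j) l‖ₑ ^ 2

/-- The weak partial derivative `∂ⱼ u = ∑ₗ 2πi lⱼ ⟨u, e_l⟩ e_l`. For `u ∈ H¹` the series converges
in `L²`; it is only evaluated meaningfully there. -/
def partialDeriv {d : ℕ} (j : Fin d) (u : ScalarField d) : ScalarField d :=
  ∑' l : Fin d → ℤ, (2 * Real.pi * Complex.I * (l j : ℂ) * fourierCoef u l) • basisFun l

/-- Pointwise multiplication of `u ∈ L²` by the bounded function `e_k`. -/
def mulBasis {d : ℕ} (k : Fin d → ℤ) (u : ScalarField d) : ScalarField d :=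
  (ContinuousMap.toLp (E := ℂ) ∞ (torusMeasure d) ℂ (UnitAddTorus.mFourier k) :
    Lp ℂ ∞ (torusMeasure d)) • u

/-- The transport term `σ·∇u`, with components `∑ⱼ aⱼ e_k ∂ⱼuₘ`, for the field `σ = a e_k`. -/
def transport {d : ℕ} (k : Fin d → ℤ) (a : EuclideanSpace ℝ (Fin d)) (u : VectorField d) :
    VectorField d :=
  WithLp.toLp 2 fun m => ∑ j, (a j : ℂ) • mulBasis k (partialDeriv j (u m))

/-- The Helmholtz projection `Π X = ∑_{l ≠ 0} (I - l ⊗ l / |l|²) X_l e_l`. -/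
def helmholtz {d : ℕ} (X : VectorField d) : VectorField d :=
  WithLp.toLp 2 fun m => ∑' l : NonzeroFreq d,
    (fourierCoef (X m) l.1 -
      (l.1 m : ℂ) * (∑ j, (l.1 j : ℂ) * fourierCoef (X j) l.1) / (freqSq l.1 : ℂ)) • basisFun l.1

/-- The heat semigroup `e^{τΔ} X = ∑ₗ exp (-4π²|l|²τ) X_l e_l`. -/
def heat {d : ℕ} (τ : ℝ) (X : VectorField d) : VectorField d :=
  WithLp.toLp 2 fun m => ∑' l : Fin d → ℤ,
    ((Real.exp (-(4 * Real.pi ^ 2 * freqSq l * τ)) : ℂ) * fourierCoef (X m) l) • basisFun l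

/-! ### The noise -/

/-- The noise coefficients: `θ` is radially symmetric and `‖θ‖_{ℓ²} = 1`. -/
structure IsNoiseCoeff {d : ℕ} (θ : NonzeroFreq d → ℝ) : Prop where
  symm : ∀ k l : NonzeroFreq d, freqSq k.1 = freqSq l.1 → θ k = θ l
  norm_one : HasSum (fun k => θ k ^ 2) 1

/-- The directions `a_{k,i}`: for each `k`, an orthonormal family of `d - 1` vectors of the
`(d-1)`-dimensional space `k^⊥` (hence an orthonormal basis of it), with `a_{-k,i} = a_{k,i}`. -/
structure IsNoiseFrame {d : ℕ} (a : NonzeroFreq d → Fin (d - 1) → EuclideanSpace ℝ (Fin d)) :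
    Prop where
  symm : ∀ k i, a (negFreq k) i = a k i
  orthonormal : ∀ k, Orthonormal ℝ (a k)
  perp : ∀ k i, ∑ j, a k i j * (k.1 j : ℝ) = 0

variable {Ω : Type*} [mΩ : MeasurableSpace Ω]

/-- The real and imaginary parts of a complex process. -/
def reIm (w : ℝ≥0 → Ω → ℂ) (b : Bool) (t : ℝ≥0) (ω : Ω) : ℝ :=
  if b then (w t ω).re else (w t ω).im

/-- `W^{k,i}` are standard complex Brownian motions for the filtration `𝓕`, independent up to the
constraint `W^{-k,i} = conj W^{k,i}`: for a half `S` of the nonzero frequencies, the real and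
imaginary parts of `W^{k,i}`, `k ∈ S`, are independent standard real Brownian motions. In terms of
brackets, `[W^{k,i}, W^{l,j}]_t = 2 t δ_{k,-l} δ_{i,j}`. -/
structure IsNoise {d : ℕ} (𝓕 : Filtration ℝ≥0 mΩ) (P : Measure Ω)
    (W : NonzeroFreq d → Fin (d - 1) → ℝ≥0 → Ω → ℂ) : Prop where
  adapted : ∀ k i, StronglyAdapted 𝓕 (W k i)
  conj_symm : ∀ k i, ∀ᵐ ω ∂P, ∀ t, W (negFreq k) i t ω = conj (W k i t ω)
  brownian : ∀ k i b, IsBrownianReal (reIm (W k i) b) P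
  indep_modes : ∃ S : Set (NonzeroFreq d), (∀ k, k ∈ S ↔ negFreq k ∉ S) ∧
    iIndepFun (fun (p : S × Fin (d - 1) × Bool) (ω : Ω) (t : ℝ≥0) =>
      reIm (W p.1.1 p.2.1) p.2.2 t ω) P
  indep_past : ∀ s t, s ≤ t →
    Indep (MeasurableSpace.comap
      (fun ω (p : NonzeroFreq d × Fin (d - 1)) => W p.1 p.2 t ω - W p.1 p.2 s ω)
      MeasurableSpace.pi) (𝓕 s) P

/-! ### The Itô integral -/

/-- A simple adapted process `∑_{i < N} ξᵢ 1_{(τᵢ, τᵢ₊₁]}`, with `ξᵢ` bounded and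
`𝓕_{τᵢ}`-measurable. -/
structure SimpleProcess (𝓕 : Filtration ℝ≥0 mΩ) (E : Type*) [NormedAddCommGroup E] where
  N : ℕ
  τ : ℕ → ℝ≥0
  τ_mono : Monotone τ
  ξ : ℕ → Ω → E
  ξ_meas : ∀ i, StronglyMeasurable[𝓕 (τ i)] (ξ i)
  ξ_bdd : ∀ i, ∃ M : ℝ, ∀ ω, ‖ξ i ω‖ ≤ M

/-- The value of a simple process at time `r`. -/
def SimpleProcess.val {𝓕 : Filtration ℝ≥0 mΩ} {E : Type*} [NormedAddCommGroup E]
    (X : SimpleProcess 𝓕 E) (r : ℝ≥0) (ω : Ω) : E :=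
  ∑ i ∈ Finset.range X.N, (Set.Ioc (X.τ i) (X.τ (i + 1))).indicator (fun _ => X.ξ i ω) r

/-- The integral `∑_{i < N} (w_{τᵢ₊₁} - w_{τᵢ}) ξᵢ` of a simple process. -/
def SimpleProcess.integral {𝓕 : Filtration ℝ≥0 mΩ} {E : Type*} [NormedAddCommGroup E]
    [NormedSpace ℂ E] (X : SimpleProcess 𝓕 E) (w : ℝ≥0 → Ω → ℂ) (ω : Ω) : E :=
  ∑ i ∈ Finset.range X.N, (w (X.τ (i + 1)) ω - w (X.τ i) ω) • X.ξ i ω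

/-- `Y = ∫_s^t Φ_r dw_r` in the sense of Itô: `Φ` is the limit in `L²((s,t] × Ω; E)` of simple
adapted processes supported in `(s,t]` whose integrals converge to `Y` in `L²(Ω; E)`. -/
def IsItoIntegral (𝓕 : Filtration ℝ≥0 mΩ) (P : Measure Ω) {E : Type*} [NormedAddCommGroup E]
    [NormedSpace ℂ E] (w : ℝ≥0 → Ω → ℂ) (s t : ℝ≥0) (Φ : ℝ≥0 → Ω → E) (Y : Ω → E) : Prop :=
  AEStronglyMeasurable Y P ∧
  ∃ X : ℕ → SimpleProcess 𝓕 E,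
    (∀ m i, (X m).τ i ∈ Set.Icc s t) ∧
    Tendsto (fun m => ∫⁻ r in Set.Ioc (s : ℝ) t,
      ∫⁻ ω, ‖(X m).val r.toNNReal ω - Φ r.toNNReal ω‖ₑ ^ 2 ∂P) atTop (𝓝 0) ∧
    Tendsto (fun m => ∫⁻ ω, ‖(X m).integral w ω - Y ω‖ₑ ^ 2 ∂P) atTop (𝓝 0)

/-! ### The energy inequality and the stochastic convolution -/

/-- Almost surely, `‖f_t‖² + ν ∫_s^t ‖∇f_r‖² dr ≤ ‖f_s‖²` for all `t > s ≥ 0`. -/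
def EnergyInequality {d : ℕ} (P : Measure Ω) (ν : ℝ) (f : ℝ≥0 → Ω → VectorField d) : Prop :=
  ∀ᵐ ω ∂P, ∀ s t : ℝ≥0, s < t →
    ‖f t ω‖ₑ ^ 2 + ENNReal.ofReal ν * ∫⁻ r in Set.Ioc (s : ℝ) t, gradNormSq (f r.toNNReal ω)
      ≤ ‖f s ω‖ₑ ^ 2

/-- `Z` is (a version of) the stochastic convolution
`Z_{s,t} = √(C_d κ) ∑_{k,i} θ_k ∫_s^t e^{δ(t-r)Δ} Π(σ_{k,i}·∇f_r) dW^{k,i}_r`, where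
`C_d = d/(d-1)`, `σ_{k,i} = a_{k,i} e_k`, and the series converges in `L²(Ω; L²(𝕋ᵈ))`. -/
def IsStochConvolution {d : ℕ} (𝓕 : Filtration ℝ≥0 mΩ) (P : Measure Ω) (κ δ : ℝ)
    (θ : NonzeroFreq d → ℝ) (a : NonzeroFreq d → Fin (d - 1) → EuclideanSpace ℝ (Fin d))
    (W : NonzeroFreq d → Fin (d - 1) → ℝ≥0 → Ω → ℂ) (f : ℝ≥0 → Ω → VectorField d)
    (s t : ℝ≥0) (Z : Ω → VectorField d) : Prop :=
  AEStronglyMeasurable Z P ∧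
  ∃ Y : NonzeroFreq d × Fin (d - 1) → Ω → VectorField d,
    (∀ p, IsItoIntegral 𝓕 P (W p.1 p.2) s t
      (fun r ω => heat (δ * ((t : ℝ) - r)) (helmholtz (transport p.1.1 (a p.1 p.2) (f r ω))))
      (Y p)) ∧
    Tendsto (fun S : Finset (NonzeroFreq d × Fin (d - 1)) =>
      ∫⁻ ω, ‖(∑ p ∈ S, ((√((d : ℝ) / ((d : ℝ) - 1) * κ) * θ p.1 : ℝ) : ℂ) • Y p ω) - Z ω‖ₑ ^ 2 ∂P)
      atTop (𝓝 0)

end TransportNoise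

end

/-!
By Itô's isometry, `𝔼‖Z_{s,t}‖²` is at most a multiple of `κ` times the integral over `(s, t]` of
the heat-damped energy `∑_l exp(-2δλ_l(t - r)) A_l(f_r)`, where `λ_l = 4π²|l|²` and `A_l(u)` is the
energy which the noise puts into the mode `l`. Since `∑_k θ_k² = 1`, these energies add up to at
most `‖∇u‖²`; individually, `A_l(u) ≤ ‖θ‖²_∞ λ_l ‖u‖²`. Interpolating between the two by Hölder's
inequality over the modes, with exponents `β/(α+β)` and `α/(α+β)`, leaves a power of the lattice
sum `∑_l λ_l^{-(2β+d)/4}`, which converges because `β > d/2`; the negative power of `λ_l` is what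
integrating the damping factor over `t` gains. The power of `‖∇f_r‖²` that remains is integrated
in `r` by Hölder's inequality and the energy inequality.
-/

namespace TransportNoise

theorem enorm_sq_eq_ofReal {E : Type*} [NormedAddCommGroup E] (x : E) :
    ‖x‖ₑ ^ 2 = ENNReal.ofReal (‖x‖ ^ 2) := by
  rw [ENNReal.ofReal_pow (norm_nonneg x), ofReal_norm]

section InnerProductSpace

variable {𝕜 E ι : Type*} [RCLike 𝕜] [NormedAddCommGroup E] [InnerProductSpace 𝕜 E]

theorem summable_smul_of_orthonormal [CompleteSpace E] {v : ι → E} (hv : Orthonormal 𝕜 v)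
    {c : ι → 𝕜} (hc : ∑' i, ‖c i‖ₑ ^ 2 ≠ ∞) : Summable fun i => c i • v i := by
  refine (hv.orthogonalFamily.summable_iff_norm_sq_summable c).2 ?_
  simpa using ENNReal.summable_toReal hc

theorem inner_tsum_smul_of_orthonormal {v : ι → E} (hv : Orthonormal 𝕜 v) {c : ι → 𝕜}
    (hc : Summable fun i => c i • v i) (i : ι) : inner 𝕜 (v i) (∑' j, c j • v j) = c i := by
  classical
  have h := hc.hasSum.mapL (innerSL 𝕜 (v i))
  simp only [innerSL_apply_apply, inner_smul_right, orthonormal_iff_ite.1 hv, mul_ite, mul_one,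
    mul_zero] at h
  exact h.unique <| by
    simpa using hasSum_single (f := fun j => if i = j then c j else 0) i fun j hj => if_neg hj.symm

theorem norm_inner_tsum_smul_le_of_orthonormal {v : ι → E} (hv : Orthonormal 𝕜 v) (c : ι → 𝕜)
    (i : ι) : ‖inner 𝕜 (v i) (∑' j, c j • v j)‖ ≤ ‖c i‖ := by
  by_cases hc : Summable fun i => c i • v i
  · rw [inner_tsum_smul_of_orthonormal hv hc]
  · simp [tsum_eq_zero_of_not_summable hc]

theorem inner_tsum_smul_of_orthogonal {v : ι → E} {w : E} (hw : ∀ i, inner 𝕜 w (v i) = 0)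
    (c : ι → 𝕜) : inner 𝕜 w (∑' i, c i • v i) = 0 := by
  by_cases hc : Summable fun i => c i • v i
  · have h := hc.hasSum.mapL (innerSL 𝕜 w)
    simp only [innerSL_apply_apply, inner_smul_right, hw, mul_zero] at h
    exact h.unique hasSum_zero
  · simp [tsum_eq_zero_of_not_summable hc]

theorem norm_sub_inner_div_smul_le (v w : E) :
    ‖w - (inner 𝕜 v w / ((‖v‖ ^ 2 : ℝ) : 𝕜)) • v‖ ≤ ‖w‖ := by
  rw [← Submodule.starProjection_singleton 𝕜, ← Submodule.starProjection_orthogonal_val]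
  exact Submodule.norm_starProjection_apply_le _ w

end InnerProductSpace

theorem norm_toLp_le_norm_toLp {ι : Type*} [Fintype ι] {x y : ι → ℂ} (h : ∀ i, ‖x i‖ ≤ ‖y i‖) :
    ‖(WithLp.toLp 2 x : EuclideanSpace ℂ ι)‖ ≤ ‖(WithLp.toLp 2 y : EuclideanSpace ℂ ι)‖ := by
  simp only [EuclideanSpace.norm_eq]
  gcongr with i
  exact h i

/-! ### Fourier coefficients -/

section FourierCoefficients

variable {d : ℕ}

theorem orthonormal_basisFun : Orthonormal ℂ (basisFun (d := d)) :=
  UnitAddTorus.orthonormal_mFourier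

theorem fourierCoef_eq_inner (u : ScalarField d) (k : Fin d → ℤ) :
    fourierCoef u k = inner ℂ (basisFun k) u := by
  have h := UnitAddTorus.mFourierBasis.repr_apply_apply u k
  rw [UnitAddTorus.mFourierBasis_repr, UnitAddTorus.coe_mFourierBasis] at h
  exact h

theorem continuous_fourierCoef (k : Fin d → ℤ) :
    Continuous fun u : ScalarField d => fourierCoef u k := by
  simp only [fourierCoef_eq_inner]
  fun_prop

theorem hasSum_norm_sq_fourierCoef (u : ScalarField d) :
    HasSum (fun l => ‖fourierCoef u l‖ ^ 2) (‖u‖ ^ 2) := by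
  have h := lp.hasSum_norm (p := 2) (by norm_num)
    ((UnitAddTorus.mFourierBasis (d := Fin d)).repr u)
  simp only [LinearIsometryEquiv.norm_map, ENNReal.toReal_ofNat, Real.rpow_ofNat,
    UnitAddTorus.mFourierBasis_repr] at h
  exact h

theorem fourierCoef_sum_smul {ι : Type*} (s : Finset ι) (c : ι → ℂ) (u : ι → ScalarField d)
    (k : Fin d → ℤ) :
    fourierCoef (∑ j ∈ s, c j • u j) k = ∑ j ∈ s, c j * fourierCoef (u j) k := by
  simp only [fourierCoef_eq_inner, inner_sum, inner_smul_right]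

theorem fourierCoef_mulBasis (k l : Fin d → ℤ) (u : ScalarField d) :
    fourierCoef (mulBasis k u) l = fourierCoef u (l - k) := by
  unfold fourierCoef mulBasis
  refine integral_congr_ae ?_
  filter_upwards [Lp.coeFn_lpSMul (r := 2) (ContinuousMap.toLp (E := ℂ) ∞ (torusMeasure d) ℂ
      (UnitAddTorus.mFourier k) : Lp ℂ ∞ (torusMeasure d)) u,
    ContinuousMap.coeFn_toLp (p := ∞) (𝕜 := ℂ) (torusMeasure d) (UnitAddTorus.mFourier k)]
    with x h_smul h_coe
  rw [h_smul, Pi.smul_apply', h_coe, smul_eq_mul, ← mul_assoc, ← UnitAddTorus.mFourier_add,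
    neg_sub, sub_eq_neg_add]

/-- The vector `X_l ∈ ℂᵈ` of the `l`-th Fourier coefficients of the components of `X`. -/
noncomputable def fourierVec (X : VectorField d) (l : Fin d → ℤ) : EuclideanSpace ℂ (Fin d) :=
  WithLp.toLp 2 fun m => fourierCoef (X m) l

/-- The frequency `l`, as a vector of `ℝᵈ`. -/
noncomputable def freqVec (l : Fin d → ℤ) : EuclideanSpace ℝ (Fin d) :=
  WithLp.toLp 2 fun j => (l j : ℝ)

/-- The eigenvalue `4π²|l|²` of `-Δ` on `e_l`. -/
noncomputable def laplaceEigenvalue (l : Fin d → ℤ) : ℝ := 4 * Real.pi ^ 2 * freqSq l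

theorem norm_sq_freqVec (l : Fin d → ℤ) : ‖freqVec l‖ ^ 2 = freqSq l :=
  EuclideanSpace.real_norm_sq_eq _

theorem inner_freqVec (l : Fin d → ℤ) (a : EuclideanSpace ℝ (Fin d)) :
    inner ℝ (freqVec l) a = ∑ j, a j * (l j : ℝ) := rfl

theorem freqSq_pos {l : Fin d → ℤ} (hl : l ≠ 0) : 0 < freqSq l := by
  obtain ⟨i, hi⟩ := Function.ne_iff.1 hl
  have hi' : (l i : ℝ) ≠ 0 := Int.cast_ne_zero.2 hi
  exact Finset.sum_pos' (fun _ _ => by positivity) ⟨i, Finset.mem_univ _, by positivity⟩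

theorem laplaceEigenvalue_pos {l : Fin d → ℤ} (hl : l ≠ 0) : 0 < laplaceEigenvalue l := by
  have := freqSq_pos hl
  unfold laplaceEigenvalue
  positivity

theorem continuous_fourierVec (l : Fin d → ℤ) :
    Continuous fun X : VectorField d => fourierVec X l :=
  (PiLp.continuous_toLp 2 _).comp <| continuous_pi fun m =>
    (continuous_fourierCoef l).comp (PiLp.continuous_apply 2 _ m)

theorem enorm_sq_fourierVec (X : VectorField d) (l : Fin d → ℤ) :
    ‖fourierVec X l‖ₑ ^ 2 = ∑ m, ‖fourierCoef (X m) l‖ₑ ^ 2 := by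
  simp only [enorm_sq_eq_ofReal, fourierVec, EuclideanSpace.norm_sq_eq]
  exact ENNReal.ofReal_sum_of_nonneg fun _ _ => sq_nonneg _

theorem enorm_sq_eq_tsum_fourierVec (X : VectorField d) :
    ‖X‖ₑ ^ 2 = ∑' l, ‖fourierVec X l‖ₑ ^ 2 := by
  have h : HasSum (fun l => ‖fourierVec X l‖ ^ 2) (‖X‖ ^ 2) := by
    simp only [fourierVec, EuclideanSpace.norm_sq_eq, PiLp.norm_sq_eq_of_L2]
    exact hasSum_sum fun m _ => hasSum_norm_sq_fourierCoef (X m)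
  simp only [enorm_sq_eq_ofReal, ← h.tsum_eq]
  exact ENNReal.ofReal_tsum_of_nonneg (fun _ => sq_nonneg _) h.summable

theorem gradNormSq_eq_tsum_fourierVec (X : VectorField d) :
    gradNormSq X = ∑' l, ENNReal.ofReal (laplaceEigenvalue l) * ‖fourierVec X l‖ₑ ^ 2 := by
  simp only [enorm_sq_fourierVec, Finset.mul_sum]
  rw [Summable.tsum_finsetSum fun _ _ => ENNReal.summable]
  rfl

theorem measurable_enorm_sq_fourierVec_comp {A : Type*} [MeasurableSpace A] {g : A → VectorField d}
    (hg : StronglyMeasurable g) (l : Fin d → ℤ) : Measurable fun x => ‖fourierVec (g x) l‖ₑ ^ 2 :=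
  ((continuous_fourierVec l).comp_stronglyMeasurable hg).enorm.pow_const 2

theorem measurable_gradNormSq_comp {A : Type*} [MeasurableSpace A] {g : A → VectorField d}
    (hg : StronglyMeasurable g) : Measurable fun x => gradNormSq (g x) := by
  simp only [gradNormSq_eq_tsum_fourierVec]
  exact .tsum fun l => (measurable_enorm_sq_fourierVec_comp hg l).const_mul _

theorem norm_fourierVec_tsum_le {ι : Type*} {g : ι → Fin d → ℤ} (hg : Function.Injective g)
    (c : Fin d → ι → ℂ) (l : ι) :
    ‖fourierVec (WithLp.toLp 2 fun m => ∑' l, c m l • basisFun (g l)) (g l)‖ ≤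
      ‖(WithLp.toLp 2 fun m => c m l : EuclideanSpace ℂ (Fin d))‖ := by
  refine norm_toLp_le_norm_toLp fun m => ?_
  rw [fourierCoef_eq_inner]
  exact norm_inner_tsum_smul_le_of_orthonormal (orthonormal_basisFun.comp g hg) (c m) l

theorem norm_fourierVec_heat_le (τ : ℝ) (X : VectorField d) (l : Fin d → ℤ) :
    ‖fourierVec (heat τ X) l‖ ≤ Real.exp (-(laplaceEigenvalue l * τ)) * ‖fourierVec X l‖ := by
  refine (norm_fourierVec_tsum_le (g := id) Function.injective_id _ l).trans_eq
    (?_ : ‖(Real.exp (-(laplaceEigenvalue l * τ)) : ℂ) • fourierVec X l‖ = _)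
  rw [norm_smul, Complex.norm_real, Real.norm_of_nonneg (Real.exp_nonneg _)]

theorem norm_fourierVec_helmholtz_le (X : VectorField d) (l : Fin d → ℤ) :
    ‖fourierVec (helmholtz X) l‖ ≤ ‖fourierVec X l‖ := by
  obtain rfl | hl := eq_or_ne l 0
  · have h_zero (m : Fin d) : fourierCoef (helmholtz X m) 0 = 0 := by
      rw [fourierCoef_eq_inner]
      refine inner_tsum_smul_of_orthogonal (fun l : NonzeroFreq d => ?_) _
      exact orthonormal_basisFun.2 l.2.symm
    exact norm_toLp_le_norm_toLp fun m => by simp [h_zero]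
  let n : EuclideanSpace ℂ (Fin d) := WithLp.toLp 2 fun j => (l j : ℂ)
  have hn : ‖n‖ ^ 2 = freqSq l := by simp [n, EuclideanSpace.norm_sq_eq, freqSq]
  have h_inner : inner ℂ n (fourierVec X l) = ∑ j, (l j : ℂ) * fourierCoef (X j) l := by
    simp [n, fourierVec, PiLp.inner_apply, mul_comm]
  refine (norm_fourierVec_tsum_le (g := fun l : NonzeroFreq d => l.1) Subtype.val_injective _
    ⟨l, hl⟩).trans (le_of_eq_of_le ?_ (norm_sub_inner_div_smul_le (𝕜 := ℂ) n (fourierVec X l)))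
  rw [hn, h_inner]
  congr 1
  ext m
  simp [n, fourierVec, mul_div_assoc, mul_comm]

theorem fourierCoef_partialDeriv {u : VectorField d} (hu : gradNormSq u ≠ ∞) (j m : Fin d)
    (l : Fin d → ℤ) :
    fourierCoef (partialDeriv j (u m)) l =
      2 * Real.pi * Complex.I * (l j : ℂ) * fourierCoef (u m) l := by
  rw [fourierCoef_eq_inner]
  refine inner_tsum_smul_of_orthonormal orthonormal_basisFun (summable_smul_of_orthonormal
    orthonormal_basisFun (ne_top_of_le_ne_top hu ?_)) l
  rw [gradNormSq_eq_tsum_fourierVec]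
  refine ENNReal.tsum_le_tsum fun l => ?_
  have h_coef : ‖2 * Real.pi * Complex.I * (l j : ℂ)‖ₑ ^ 2 ≤
      ENNReal.ofReal (laplaceEigenvalue l) := by
    have h_le : (l j : ℝ) ^ 2 ≤ freqSq l :=
      Finset.single_le_sum (f := fun j => (l j : ℝ) ^ 2) (fun _ _ => sq_nonneg _)
        (Finset.mem_univ j)
    rw [enorm_sq_eq_ofReal]
    refine ENNReal.ofReal_le_ofReal (le_of_eq_of_le ?_
      (mul_le_mul_of_nonneg_left h_le (by positivity : 0 ≤ 4 * Real.pi ^ 2)))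
    have h_four : (2 : ℝ) ^ 2 = 4 := by norm_num
    simp [mul_pow, h_four]
  have h_comp : ‖fourierCoef (u m) l‖ₑ ^ 2 ≤ ‖fourierVec u l‖ₑ ^ 2 :=
    pow_le_pow_left' (PiLp.enorm_apply_le (fourierVec u l) m) 2
  rw [enorm_mul, mul_pow]
  exact mul_le_mul' h_coef h_comp

theorem fourierVec_transport {u : VectorField d} (hu : gradNormSq u ≠ ∞) {k : Fin d → ℤ}
    {a : EuclideanSpace ℝ (Fin d)} (ha : inner ℝ (freqVec k) a = 0) (l : Fin d → ℤ) :
    fourierVec (transport k a u) l =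
      (2 * Real.pi * Complex.I * (inner ℝ (freqVec l) a : ℝ)) • fourierVec u (l - k) := by
  have h_shift : inner ℝ (freqVec l) a = ∑ j, a j * ((l - k) j : ℝ) := by
    rw [inner_freqVec] at ha
    simp [inner_freqVec, mul_sub, Finset.sum_sub_distrib, ha]
  ext m
  simp only [fourierVec, transport, fourierCoef_sum_smul, fourierCoef_mulBasis,
    fourierCoef_partialDeriv hu, PiLp.smul_apply, smul_eq_mul, h_shift]
  push_cast
  rw [Finset.mul_sum, Finset.sum_mul]
  exact Finset.sum_congr rfl fun j _ => by ring

/-- The contribution `|(a·∇u)_{l-k}|² = 4π²(a·l)²|u_{l-k}|²` of the mode `l` to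
`‖(a e_k)·∇u‖²`, for `a ⟂ k`. -/
noncomputable def transportEnergy (k : Fin d → ℤ) (a : EuclideanSpace ℝ (Fin d))
    (u : VectorField d) (l : Fin d → ℤ) : ℝ≥0∞ :=
  ENNReal.ofReal ((2 * Real.pi * inner ℝ (freqVec l) a) ^ 2) * ‖fourierVec u (l - k)‖ₑ ^ 2

theorem enorm_sq_heat_helmholtz_transport_le {u : VectorField d} (hu : gradNormSq u ≠ ∞)
    {k : Fin d → ℤ} {a : EuclideanSpace ℝ (Fin d)} (ha : inner ℝ (freqVec k) a = 0) (τ : ℝ) :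
    ‖heat τ (helmholtz (transport k a u))‖ₑ ^ 2 ≤
      ∑' l, ENNReal.ofReal (Real.exp (-(2 * (laplaceEigenvalue l * τ)))) *
        transportEnergy k a u l := by
  rw [enorm_sq_eq_tsum_fourierVec]
  refine ENNReal.tsum_le_tsum fun l => ?_
  have h_norm : ‖fourierVec (heat τ (helmholtz (transport k a u))) l‖ ≤
      Real.exp (-(laplaceEigenvalue l * τ)) *
        (|2 * Real.pi * inner ℝ (freqVec l) a| * ‖fourierVec u (l - k)‖) := by
    refine (norm_fourierVec_heat_le _ _ l).trans ?_
    gcongr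
    refine (norm_fourierVec_helmholtz_le _ l).trans_eq ?_
    rw [fourierVec_transport hu ha, norm_smul]
    simp [abs_mul]
  rw [transportEnergy, enorm_sq_eq_ofReal, enorm_sq_eq_ofReal,
    ← ENNReal.ofReal_mul (by positivity), ← ENNReal.ofReal_mul (by positivity)]
  refine ENNReal.ofReal_le_ofReal ((pow_le_pow_left₀ (norm_nonneg _) h_norm 2).trans_eq ?_)
  rw [mul_pow, mul_pow, sq_abs, ← Real.exp_nat_mul]
  congr 2
  push_cast
  ring

end FourierCoefficients

/-! ### Simple processes on a common grid -/

theorem exists_monotone_enumeration {α : Type*} [LinearOrder α] {T : Finset α} (hT : T.Nonempty) :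
    ∃ (M : ℕ) (t : ℕ → α), Monotone t ∧ (∀ j, t j ∈ T) ∧ (∀ x ∈ T, x ∈ Set.Icc (t 0) (t M)) ∧
      ∀ x ∈ T, ∀ j, x < t (j + 1) → x ≤ t j := by
  have h_card : 0 < T.card := hT.card_pos
  let e := T.orderEmbOfFin rfl
  have h_surj : ∀ x ∈ T, ∃ i, e i = x := fun x hx => by
    rwa [← Set.mem_range, Finset.range_orderEmbOfFin]
  refine ⟨T.card - 1, fun j => e ⟨min j (T.card - 1), by omega⟩,
    fun i j hij => e.monotone (Fin.mk_le_mk.2 (by omega)),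
    fun j => Finset.orderEmbOfFin_mem _ _ _, fun x hx => ?_, fun x hx j hj => ?_⟩
  · obtain ⟨i, rfl⟩ := h_surj x hx
    exact ⟨e.monotone (Fin.le_def.2 (by simp)), e.monotone (Fin.le_def.2 (by simp; omega))⟩
  · obtain ⟨i, rfl⟩ := h_surj x hx
    have h_lt := Fin.lt_def.1 (e.lt_iff_lt.1 hj)
    exact e.monotone (Fin.le_def.2 (by simp only at h_lt ⊢; omega))

theorem sub_smul_indicator_Ioc_eq {α R E : Type*} [LinearOrder α] [Ring R] [AddCommGroup E]
    [Module R E] {x y t t' : α} (ht : t ≤ t') (hx : x < t' → x ≤ t)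
    (hy : y < t' → y ≤ t) (w : α → R) (ξ : E) :
    (w t' - w t) • (Set.Ioc x y).indicator (fun _ => ξ) t' =
      (w (max x (min t' y)) - w (max x (min t y))) • ξ := by
  rcases le_or_gt t' x with hxt | hxt
  · rw [Set.indicator_of_notMem fun hm => hxt.not_gt hm.1, max_eq_left (min_le_of_left_le hxt),
      max_eq_left (min_le_of_left_le (ht.trans hxt)), smul_zero, sub_self, zero_smul]
  rcases le_or_gt t' y with hyt | hyt
  · rw [Set.indicator_of_mem (Set.mem_Ioc.2 ⟨hxt, hyt⟩), min_eq_left hyt, max_eq_right hxt.le,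
      min_eq_left (ht.trans hyt), max_eq_right (hx hxt)]
  · rw [Set.indicator_of_notMem fun hm => hyt.not_ge hm.2, min_eq_right hyt.le,
      min_eq_right (hy hyt), smul_zero, sub_self, zero_smul]

section CommonGrid

variable {Ω : Type*} [mΩ : MeasurableSpace Ω] {𝓕 : Filtration ℝ≥0 mΩ} {P : Measure Ω}

namespace SimpleProcess

variable {E : Type*} [NormedAddCommGroup E] {X : SimpleProcess 𝓕 E} {t : ℕ → ℝ≥0} {M : ℕ}

/-- The grid `t 0 ≤ t 1 ≤ ... ≤ t M` refines the partition of the simple process `X`: no jump time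
of `X` lies strictly between two consecutive nodes. -/
structure OnGrid (X : SimpleProcess 𝓕 E) (t : ℕ → ℝ≥0) (M : ℕ) : Prop where
  mono : Monotone t
  mem_Icc : ∀ i ≤ X.N, X.τ i ∈ Set.Icc (t 0) (t M)
  le_of_lt_succ : ∀ i ≤ X.N, ∀ j, X.τ i < t (j + 1) → X.τ i ≤ t j

theorem exists_onGrid {ι : Type*} {S : Finset ι} (hS : S.Nonempty) (X : ι → SimpleProcess 𝓕 E)
    {a b : ℝ≥0} (hX : ∀ p ∈ S, ∀ i, (X p).τ i ∈ Set.Icc a b) :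
    ∃ (M : ℕ) (t : ℕ → ℝ≥0), (∀ j, t j ∈ Set.Icc a b) ∧ ∀ p ∈ S, (X p).OnGrid t M := by
  let T := S.biUnion fun p => (Finset.range ((X p).N + 1)).image (X p).τ
  have h_mem : ∀ p ∈ S, ∀ i ≤ (X p).N, (X p).τ i ∈ T := fun p hp i hi =>
    Finset.mem_biUnion.2 ⟨p, hp, Finset.mem_image_of_mem _ (Finset.mem_range.2 (by omega))⟩
  have h_sub : ∀ x ∈ T, x ∈ Set.Icc a b := by
    simp only [T, Finset.mem_biUnion, Finset.mem_image]
    rintro _ ⟨p, hp, i, -, rfl⟩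
    exact hX p hp i
  obtain ⟨p₀, hp₀⟩ := hS
  obtain ⟨M, t, h_mono, h_grid, h_Icc, h_succ⟩ :=
    exists_monotone_enumeration ⟨_, h_mem p₀ hp₀ 0 (Nat.zero_le _)⟩
  exact ⟨M, t, fun j => h_sub _ (h_grid j), fun p hp =>
    ⟨h_mono, fun i hi => h_Icc _ (h_mem p hp i hi), fun i hi => h_succ _ (h_mem p hp i hi)⟩⟩

theorem exists_norm_val_le (X : SimpleProcess 𝓕 E) (r : ℝ≥0) :
    ∃ C : ℝ, ∀ ω, ‖X.val r ω‖ ≤ C := by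
  choose C hC using X.ξ_bdd
  exact ⟨∑ i ∈ Finset.range X.N, C i, fun ω => norm_sum_le_of_le _ fun i _ =>
    (norm_indicator_le_norm_self _ _).trans (hC i ω)⟩

namespace OnGrid

theorem val_eq (h : X.OnGrid t M) {j : ℕ} {r : ℝ≥0} (hr : r ∈ Set.Ioc (t j) (t (j + 1))) :
    X.val r = X.val (t (j + 1)) := by
  funext ω
  refine Finset.sum_congr rfl fun i hi => ?_
  have hi := Finset.mem_range.1 hi
  have h_lt (i) (hi : i ≤ X.N) : X.τ i < r ↔ X.τ i < t (j + 1) :=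
    ⟨fun h' => h'.trans_le hr.2, fun h' => (h.le_of_lt_succ i hi j h').trans_lt hr.1⟩
  have h_le : r ≤ X.τ (i + 1) ↔ t (j + 1) ≤ X.τ (i + 1) := by
    rw [← not_lt, h_lt (i + 1) hi, not_lt]
  simp only [Set.indicator_apply, Set.mem_Ioc, h_lt i hi.le, h_le]

theorem integral_eq [NormedSpace ℂ E] (h : X.OnGrid t M) (w : ℝ≥0 → Ω → ℂ) (ω : Ω) :
    X.integral w ω =
      ∑ j ∈ Finset.range M, (w (t (j + 1)) ω - w (t j) ω) • X.val (t (j + 1)) ω := by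
  simp only [SimpleProcess.integral, SimpleProcess.val, Finset.smul_sum]
  rw [Finset.sum_comm]
  refine Finset.sum_congr rfl fun i hi => ?_
  have hi := Finset.mem_range.1 hi
  have hτ : X.τ i ≤ X.τ (i + 1) := X.τ_mono (Nat.le_succ i)
  let clamp (x : ℝ≥0) : ℝ≥0 := max (X.τ i) (min x (X.τ (i + 1)))
  have h_first : clamp (t 0) = X.τ i := max_eq_left (min_le_of_left_le (h.mem_Icc i hi.le).1)
  have h_last : clamp (t M) = X.τ (i + 1) := by
    simp only [clamp, min_eq_right (h.mem_Icc (i + 1) hi).2, max_eq_right hτ]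
  symm
  calc ∑ j ∈ Finset.range M, (w (t (j + 1)) ω - w (t j) ω) •
        (Set.Ioc (X.τ i) (X.τ (i + 1))).indicator (fun _ => X.ξ i ω) (t (j + 1))
      = ∑ j ∈ Finset.range M, (w (clamp (t (j + 1))) ω - w (clamp (t j)) ω) • X.ξ i ω :=
        Finset.sum_congr rfl fun j _ => sub_smul_indicator_Ioc_eq (h.mono (Nat.le_succ j))
          (h.le_of_lt_succ i hi.le j) (h.le_of_lt_succ (i + 1) hi j) (fun r => w r ω) _
    _ = (w (X.τ (i + 1)) ω - w (X.τ i) ω) • X.ξ i ω := by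
        rw [← Finset.sum_smul, Finset.sum_range_sub fun j => w (clamp (t j)) ω, h_first, h_last]

theorem stronglyMeasurable_val (h : X.OnGrid t M) (j : ℕ) :
    StronglyMeasurable[𝓕 (t j)] (X.val (t (j + 1))) := by
  unfold SimpleProcess.val
  refine Finset.stronglyMeasurable_fun_sum _ fun i hi => ?_
  simp only [Set.indicator_apply, Set.mem_Ioc]
  split_ifs with hm
  · exact (X.ξ_meas i).mono (𝓕.mono (h.le_of_lt_succ i (Finset.mem_range.1 hi).le j hm.1))
  · exact stronglyMeasurable_const

theorem sum_lintegral_val_le (h : X.OnGrid t M) {a b : ℝ≥0} (hab : ∀ j, t j ∈ Set.Icc a b) :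
    ∑ j ∈ Finset.range M, ENNReal.ofReal ((t (j + 1) : ℝ) - t j) *
        ∫⁻ ω, ‖X.val (t (j + 1)) ω‖ₑ ^ 2 ∂P ≤
      ∫⁻ r in Set.Ioc (a : ℝ) b, ∫⁻ ω, ‖X.val r.toNNReal ω‖ₑ ^ 2 ∂P := by
  have h_cell (j : ℕ) : ENNReal.ofReal ((t (j + 1) : ℝ) - t j) *
        ∫⁻ ω, ‖X.val (t (j + 1)) ω‖ₑ ^ 2 ∂P =
      ∫⁻ r in Set.Ioc (t j : ℝ) (t (j + 1)), ∫⁻ ω, ‖X.val r.toNNReal ω‖ₑ ^ 2 ∂P := by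
    rw [setLIntegral_congr_fun (g := fun _ => ∫⁻ ω, ‖X.val (t (j + 1)) ω‖ₑ ^ 2 ∂P)
      measurableSet_Ioc, setLIntegral_const, Real.volume_Ioc, mul_comm]
    intro r hr
    have hr' : r.toNNReal ∈ Set.Ioc (t j) (t (j + 1)) :=
      ⟨Real.lt_toNNReal_iff_coe_lt.2 hr.1, Real.toNNReal_le_iff_le_coe.2 hr.2⟩
    simp only [h.val_eq hr']
  have h_mono : Monotone fun j => (t j : ℝ) := NNReal.coe_mono.comp h.mono
  simp only [h_cell]
  rw [← lintegral_biUnion_finset]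
  · exact lintegral_mono_set (Set.iUnion₂_subset fun j _ =>
      Set.Ioc_subset_Ioc (hab j).1 (hab (j + 1)).2)
  · intro i _ j _ hij
    simpa using h_mono.pairwise_disjoint_on_Ioc_succ hij
  · exact fun _ _ => measurableSet_Ioc

end OnGrid

end SimpleProcess

end CommonGrid

/-! ### The Itô isometry -/

section ItoIsometry

variable {Ω : Type*} [mΩ : MeasurableSpace Ω] {𝓕 : Filtration ℝ≥0 mΩ} {P : Measure Ω}

theorem lintegral_enorm_sq_eq_ofReal {E : Type*} [NormedAddCommGroup E] {f : Ω → E}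
    (hf : MemLp f 2 P) :
    ∫⁻ ω, ‖f ω‖ₑ ^ 2 ∂P = ENNReal.ofReal (∫ ω, ‖f ω‖ ^ 2 ∂P) := by
  rw [ofReal_integral_eq_lintegral_ofReal (hf.integrable_norm_pow (by norm_num))
    (ae_of_all _ fun _ => by positivity)]
  simp only [enorm_sq_eq_ofReal]

section InnerProductSpace

variable {E : Type*} [NormedAddCommGroup E] [InnerProductSpace ℂ E]

theorem integrable_inner_of_memLp_two {f g : Ω → E} (hf : MemLp f 2 P) (hg : MemLp g 2 P) :
    Integrable (fun ω => inner ℂ (f ω) (g ω)) P :=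
  (hf.norm.integrable_mul hg.norm).mono' (hf.1.inner hg.1)
    (ae_of_all _ fun _ => norm_inner_le_norm _ _)

theorem ofReal_integral_norm_sq (f : Ω → E) :
    ((∫ ω, ‖f ω‖ ^ 2 ∂P : ℝ) : ℂ) = ∫ ω, inner ℂ (f ω) (f ω) ∂P := by
  simp only [← integral_complex_ofReal, inner_self_eq_norm_sq_to_K, Complex.ofReal_pow,
    Complex.coe_algebraMap]

theorem lintegral_enorm_sq_sum_of_orthogonal {A : Type*} (s : Finset A) {U : A → Ω → E}
    (hU : ∀ a ∈ s, MemLp (U a) 2 P)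
    (ho : ∀ a ∈ s, ∀ b ∈ s, a ≠ b → ∫ ω, inner ℂ (U a ω) (U b ω) ∂P = 0) :
    ∫⁻ ω, ‖∑ a ∈ s, U a ω‖ₑ ^ 2 ∂P = ∑ a ∈ s, ∫⁻ ω, ‖U a ω‖ₑ ^ 2 ∂P := by
  have h_mem : MemLp (fun ω => ∑ a ∈ s, U a ω) 2 P := memLp_finsetSum s hU
  have h_int : ∫ ω, ‖∑ a ∈ s, U a ω‖ ^ 2 ∂P = ∑ a ∈ s, ∫ ω, ‖U a ω‖ ^ 2 ∂P := by
    refine Complex.ofReal_injective ?_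
    simp only [Complex.ofReal_sum, ofReal_integral_norm_sq, sum_inner]
    simp only [inner_sum]
    rw [integral_finsetSum _ fun a ha => integrable_finsetSum _ fun b hb =>
      integrable_inner_of_memLp_two (hU a ha) (hU b hb)]
    refine Finset.sum_congr rfl fun a ha => ?_
    rw [integral_finsetSum _ fun b hb => integrable_inner_of_memLp_two (hU a ha) (hU b hb)]
    exact Finset.sum_eq_single a (fun b hb hba => ho a ha b hb hba.symm) fun h => absurd ha h
  rw [lintegral_enorm_sq_eq_ofReal h_mem, h_int,
    ENNReal.ofReal_sum_of_nonneg fun a _ => integral_nonneg fun ω => sq_nonneg ‖U a ω‖]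
  exact Finset.sum_congr rfl fun a ha => (lintegral_enorm_sq_eq_ofReal (hU a ha)).symm

end InnerProductSpace

/-- A family of adapted square integrable complex processes with centred, mutually uncorrelated
increments of variance `2 (t - s)`, the increments of the whole family being independent of the
past. This is all that the Itô isometry needs to know about the noise. -/
structure IsOrthogonalNoise {ι : Type*} (𝓕 : Filtration ℝ≥0 mΩ) (P : Measure Ω)
    (W : ι → ℝ≥0 → Ω → ℂ) : Prop where
  adapted : ∀ p, StronglyAdapted 𝓕 (W p)
  memLp : ∀ p s t, MemLp (fun ω => W p t ω - W p s ω) 2 P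
  mean : ∀ p s t, ∫ ω, (W p t ω - W p s ω) ∂P = 0
  variance : ∀ p s t, s ≤ t →
    ∫ ω, conj (W p t ω - W p s ω) * (W p t ω - W p s ω) ∂P = (2 * ((t : ℝ) - s) : ℝ)
  uncorrelated : ∀ p q, p ≠ q → ∀ s t, s ≤ t →
    ∫ ω, conj (W p t ω - W p s ω) * (W q t ω - W q s ω) ∂P = 0
  indep_past : ∀ s t, s ≤ t → Indep (MeasurableSpace.comap (fun ω p => W p t ω - W p s ω)
    MeasurableSpace.pi) (𝓕 s) P

namespace IsOrthogonalNoise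

variable {ι E : Type*} [NormedAddCommGroup E] [InnerProductSpace ℂ E] {W : ι → ℝ≥0 → Ω → ℂ}

theorem memLp_smul (hW : IsOrthogonalNoise 𝓕 P W) (p : ι) (s t : ℝ≥0)
    {η : Ω → E} (hη : AEStronglyMeasurable η P) {C : ℝ} (hC : ∀ ω, ‖η ω‖ ≤ C) :
    MemLp (fun ω => (W p t ω - W p s ω) • η ω) 2 P :=
  (memLp_top_of_bound hη C (ae_of_all _ hC)).smul (hW.memLp p s t)

theorem indepFun_past (hW : IsOrthogonalNoise 𝓕 P W) {s t : ℝ≥0} (hst : s ≤ t)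
    {g : (ι → ℂ) → ℂ} (hg : Measurable g) {Y : Ω → ℂ} (hY : StronglyMeasurable[𝓕 s] Y) :
    IndepFun (fun ω => g fun p => W p t ω - W p s ω) Y P := by
  rw [IndepFun_iff_Indep]
  refine indep_of_indep_of_le (hW.indep_past s t hst) ?_ hY.measurable.comap_le
  rw [show (fun ω => g fun p => W p t ω - W p s ω) = g ∘ fun ω p => W p t ω - W p s ω from rfl,
    ← MeasurableSpace.comap_comp]
  exact MeasurableSpace.comap_mono hg.comap_le

theorem integral_inner_past_smul (hW : IsOrthogonalNoise 𝓕 P W) (p : ι) {s t : ℝ≥0}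
    (hst : s ≤ t) {A η : Ω → E} (hA : StronglyMeasurable[𝓕 s] A)
    (hη : StronglyMeasurable[𝓕 s] η) :
    ∫ ω, inner ℂ (A ω) ((W p t ω - W p s ω) • η ω) ∂P = 0 := by
  have hY : StronglyMeasurable[𝓕 s] fun ω => inner ℂ (A ω) (η ω) := hA.inner hη
  have h_indep := hW.indepFun_past hst (measurable_pi_apply p) hY
  simp only [inner_smul_right]
  rw [h_indep.integral_fun_mul_eq_mul_integral (hW.memLp p s t).1
    (hY.mono (𝓕.le s)).aestronglyMeasurable, hW.mean, zero_mul]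

theorem integral_inner_smul_smul (hW : IsOrthogonalNoise 𝓕 P W) (p q : ι) {s t : ℝ≥0}
    (hst : s ≤ t) {A η : Ω → E} (hA : StronglyMeasurable[𝓕 s] A)
    (hη : StronglyMeasurable[𝓕 s] η) :
    ∫ ω, inner ℂ ((W p t ω - W p s ω) • A ω) ((W q t ω - W q s ω) • η ω) ∂P =
      (∫ ω, conj (W p t ω - W p s ω) * (W q t ω - W q s ω) ∂P) *
        ∫ ω, inner ℂ (A ω) (η ω) ∂P := by
  have hY : StronglyMeasurable[𝓕 s] fun ω => inner ℂ (A ω) (η ω) := hA.inner hη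
  have h_indep := hW.indepFun_past hst (g := fun x => conj (x p) * x q)
    ((Complex.continuous_conj.measurable.comp (measurable_pi_apply p)).mul
      (measurable_pi_apply q)) hY
  rw [← h_indep.integral_fun_mul_eq_mul_integral
    ((Complex.continuous_conj.comp_aestronglyMeasurable (hW.memLp p s t).1).mul
      (hW.memLp q s t).1) (hY.mono (𝓕.le s)).aestronglyMeasurable]
  simp only [inner_smul_right, inner_smul_left]
  exact integral_congr_ae (ae_of_all _ fun ω => by ring)

theorem lintegral_enorm_sq_smul (hW : IsOrthogonalNoise 𝓕 P W) (p : ι)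
    {s t : ℝ≥0} (hst : s ≤ t) {η : Ω → E} (hη : StronglyMeasurable[𝓕 s] η) (hη_mem : MemLp η 2 P)
    (hη_smul : MemLp (fun ω => (W p t ω - W p s ω) • η ω) 2 P) :
    ∫⁻ ω, ‖(W p t ω - W p s ω) • η ω‖ₑ ^ 2 ∂P =
      ENNReal.ofReal (2 * ((t : ℝ) - s)) * ∫⁻ ω, ‖η ω‖ₑ ^ 2 ∂P := by
  have hst' : (0 : ℝ) ≤ t - s := sub_nonneg.2 (NNReal.coe_le_coe.2 hst)
  rw [lintegral_enorm_sq_eq_ofReal hη_smul, lintegral_enorm_sq_eq_ofReal hη_mem,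
    ← ENNReal.ofReal_mul (by positivity)]
  congr 1
  refine Complex.ofReal_injective ?_
  rw [Complex.ofReal_mul, ofReal_integral_norm_sq, ofReal_integral_norm_sq,
    ← hW.variance p s t hst, hW.integral_inner_smul_smul p p hst hη hη]

variable {t : ℕ → ℝ≥0}

theorem integral_inner_increment_smul (hW : IsOrthogonalNoise 𝓕 P W) (ht : Monotone t)
    {η η' : ℕ → Ω → E} (hη : ∀ j, StronglyMeasurable[𝓕 (t j)] (η j))
    (hη' : ∀ j, StronglyMeasurable[𝓕 (t j)] (η' j)) {p q : ι} {i j : ℕ} (hne : (p, i) ≠ (q, j)) :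
    ∫ ω, inner ℂ ((W p (t (i + 1)) ω - W p (t i) ω) • η i ω)
      ((W q (t (j + 1)) ω - W q (t j) ω) • η' j ω) ∂P = 0 := by
  have h_past {ζ : ℕ → Ω → E} (hζ : ∀ j, StronglyMeasurable[𝓕 (t j)] (ζ j)) (p : ι) {i j : ℕ}
      (hij : i < j) : StronglyMeasurable[𝓕 (t j)]
        fun ω => (W p (t (i + 1)) ω - W p (t i) ω) • ζ i ω :=
    (((hW.adapted p _).mono (𝓕.mono (ht hij))).sub
      ((hW.adapted p _).mono (𝓕.mono (ht hij.le)))).smul ((hζ i).mono (𝓕.mono (ht hij.le)))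
  rcases lt_trichotomy i j with hij | rfl | hij
  · exact hW.integral_inner_past_smul q (ht (Nat.le_succ j)) (h_past hη p hij) (hη' j)
  · have hpq : p ≠ q := fun h => hne (congrArg (·, i) h)
    rw [hW.integral_inner_smul_smul p q (ht (Nat.le_succ i)) (hη i) (hη' i),
      hW.uncorrelated p q hpq _ _ (ht (Nat.le_succ i)), zero_mul]
  · have h := hW.integral_inner_past_smul p (ht (Nat.le_succ i)) (h_past hη' q hij) (hη i)
    have h_conj := congrArg conj h
    rw [← integral_conj, map_zero] at h_conj
    simpa only [inner_conj_symm] using h_conj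

theorem lintegral_enorm_sq_sum_increment_smul [IsFiniteMeasure P] (hW : IsOrthogonalNoise 𝓕 P W)
    (ht : Monotone t) (S : Finset ι) (M : ℕ) {η : ι → ℕ → Ω → E}
    (hη : ∀ p ∈ S, ∀ j, StronglyMeasurable[𝓕 (t j)] (η p j))
    (hη_bdd : ∀ p ∈ S, ∀ j, ∃ C : ℝ, ∀ ω, ‖η p j ω‖ ≤ C) :
    ∫⁻ ω, ‖∑ p ∈ S, ∑ j ∈ Finset.range M,
        (W p (t (j + 1)) ω - W p (t j) ω) • η p j ω‖ₑ ^ 2 ∂P =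
      ∑ p ∈ S, ∑ j ∈ Finset.range M,
        ENNReal.ofReal (2 * ((t (j + 1) : ℝ) - t j)) * ∫⁻ ω, ‖η p j ω‖ₑ ^ 2 ∂P := by
  have hη_aesm : ∀ p ∈ S, ∀ j, AEStronglyMeasurable (η p j) P := fun p hp j =>
    ((hη p hp j).mono (𝓕.le _)).aestronglyMeasurable
  have h_mem : ∀ p ∈ S, ∀ j,
      MemLp (fun ω => (W p (t (j + 1)) ω - W p (t j) ω) • η p j ω) 2 P := fun p hp j =>
    have ⟨_, hC⟩ := hη_bdd p hp j
    hW.memLp_smul p _ _ (hη_aesm p hp j) hC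
  simp only [← Finset.sum_product']
  rw [lintegral_enorm_sq_sum_of_orthogonal]
  · refine Finset.sum_congr rfl fun z hz => ?_
    obtain ⟨hp, -⟩ := Finset.mem_product.1 hz
    obtain ⟨C, hC⟩ := hη_bdd z.1 hp z.2
    exact hW.lintegral_enorm_sq_smul z.1 (ht (Nat.le_succ _)) (hη z.1 hp z.2)
      (.of_bound (hη_aesm z.1 hp z.2) C (ae_of_all _ hC)) (h_mem z.1 hp z.2)
  · exact fun z hz => h_mem z.1 (Finset.mem_product.1 hz).1 z.2
  · exact fun z hz z' hz' hne => hW.integral_inner_increment_smul ht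
      (hη z.1 (Finset.mem_product.1 hz).1) (hη z'.1 (Finset.mem_product.1 hz').1) hne

theorem lintegral_enorm_sq_sum_integral_le [IsFiniteMeasure P] (hW : IsOrthogonalNoise 𝓕 P W)
    (S : Finset ι) (c : ι → ℂ) (X : ι → SimpleProcess 𝓕 E) {a b : ℝ≥0}
    (hX : ∀ p ∈ S, ∀ i, (X p).τ i ∈ Set.Icc a b) :
    ∫⁻ ω, ‖∑ p ∈ S, c p • (X p).integral (W p) ω‖ₑ ^ 2 ∂P ≤
      ∑ p ∈ S, 2 * ‖c p‖ₑ ^ 2 *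
        ∫⁻ r in Set.Ioc (a : ℝ) b, ∫⁻ ω, ‖(X p).val r.toNNReal ω‖ₑ ^ 2 ∂P := by
  obtain rfl | hS := S.eq_empty_or_nonempty
  · simp
  obtain ⟨M, t, htab, h_grid⟩ := SimpleProcess.exists_onGrid hS X hX
  have ht : Monotone t := have ⟨p, hp⟩ := hS; (h_grid p hp).mono
  let η (p : ι) (j : ℕ) (ω : Ω) : E := c p • (X p).val (t (j + 1)) ω
  have hη_bdd (p j) : ∃ C : ℝ, ∀ ω, ‖η p j ω‖ ≤ C := by
    obtain ⟨C, hC⟩ := (X p).exists_norm_val_le (t (j + 1))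
    exact ⟨‖c p‖ * C, fun ω => (norm_smul_le _ _).trans
      (mul_le_mul_of_nonneg_left (hC ω) (norm_nonneg _))⟩
  have h_sum (ω : Ω) : ∑ p ∈ S, c p • (X p).integral (W p) ω =
      ∑ p ∈ S, ∑ j ∈ Finset.range M, (W p (t (j + 1)) ω - W p (t j) ω) • η p j ω := by
    refine Finset.sum_congr rfl fun p hp => ?_
    rw [(h_grid p hp).integral_eq, Finset.smul_sum]
    exact Finset.sum_congr rfl fun j _ => smul_comm _ _ _
  simp only [h_sum]
  rw [hW.lintegral_enorm_sq_sum_increment_smul (η := η) ht S M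
    (fun p hp j => ((h_grid p hp).stronglyMeasurable_val j).const_smul (c p))
    fun p _ => hη_bdd p]
  refine Finset.sum_le_sum fun p hp => ?_
  refine le_of_eq_of_le ?_ (mul_le_mul_right ((h_grid p hp).sum_lintegral_val_le htab) _)
  rw [Finset.mul_sum]
  refine Finset.sum_congr rfl fun j _ => ?_
  simp only [η, enorm_smul, mul_pow]
  rw [lintegral_const_mul' _ _ (by simp), ENNReal.ofReal_mul zero_le_two, ENNReal.ofReal_ofNat]
  ring

end IsOrthogonalNoise

end ItoIsometry

/-! ### The Itô isometry for limits of simple processes -/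

theorem sq_add_le_young {ε : ℝ≥0} (hε : 0 < ε) (x y : ℝ≥0∞) :
    (x + y) ^ 2 ≤ (1 + ε) * x ^ 2 + (1 + (ε : ℝ≥0∞)⁻¹) * y ^ 2 := by
  rcases eq_or_ne x ∞ with rfl | hx
  · simp
  rcases eq_or_ne y ∞ with rfl | hy
  · simp
  lift x to ℝ≥0 using hx
  lift y to ℝ≥0 using hy
  rw [← ENNReal.coe_inv hε.ne']
  norm_cast
  rw [← NNReal.coe_le_coe]
  push_cast
  have h_young : 2 * (x * y : ℝ) ≤ ε * x ^ 2 + (ε : ℝ)⁻¹ * y ^ 2 := by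
    have h_sq : 0 ≤ (ε : ℝ)⁻¹ * (ε * x - y) ^ 2 := by positivity
    have h_eq : (ε : ℝ)⁻¹ * (ε * x - y) ^ 2 = ε * x ^ 2 + (ε : ℝ)⁻¹ * y ^ 2 - 2 * (x * y) := by
      field_simp
      ring
    linarith
  linarith

theorem le_of_forall_le_one_add_mul {x y : ℝ≥0∞}
    (h : ∀ ε : ℝ≥0, 0 < ε → x ≤ (1 + ε) * y) : x ≤ y := by
  have h_lim : Tendsto (fun ε : ℝ≥0 => (1 + (ε : ℝ≥0∞)) * y) (𝓝[>] 0) (𝓝 ((1 + (0 : ℝ≥0)) * y)) :=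
    ENNReal.Tendsto.mul_const
      ((tendsto_const_nhds.add (ENNReal.tendsto_coe.2 tendsto_id)).mono_left nhdsWithin_le_nhds)
      (Or.inl (by simp))
  simpa using ge_of_tendsto h_lim (eventually_mem_nhdsWithin.mono h)

section ItoLimit

variable {Ω : Type*} [mΩ : MeasurableSpace Ω] {𝓕 : Filtration ℝ≥0 mΩ} {P : Measure Ω}

section NormedAddCommGroup

variable {E : Type*} [NormedAddCommGroup E]

theorem lintegral_enorm_sq_le_of_tendsto {A : Type*} {l : Filter A} [l.NeBot] {F : A → Ω → E}
    {Y : Ω → E} (hF : ∀ i, AEStronglyMeasurable (F i) P)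
    (h_lim : Tendsto (fun i => ∫⁻ ω, ‖F i ω - Y ω‖ₑ ^ 2 ∂P) l (𝓝 0)) {B : A → ℝ≥0∞} {C : ℝ≥0∞}
    (hB : ∀ i, ∫⁻ ω, ‖F i ω‖ₑ ^ 2 ∂P ≤ B i) (hBC : Tendsto B l (𝓝 C)) :
    ∫⁻ ω, ‖Y ω‖ₑ ^ 2 ∂P ≤ C := by
  refine le_of_forall_le_one_add_mul fun ε hε => ?_
  have h_le (i) : ∫⁻ ω, ‖Y ω‖ₑ ^ 2 ∂P ≤
      (1 + ε) * B i + (1 + (ε : ℝ≥0∞)⁻¹) * ∫⁻ ω, ‖F i ω - Y ω‖ₑ ^ 2 ∂P := by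
    refine le_trans ?_ (add_le_add_left (mul_le_mul_right (hB i) _) _)
    rw [← lintegral_const_mul'' _ ((hF i).enorm.pow_const 2), ← lintegral_const_mul' _ _
      (by simp [hε.ne']), ← lintegral_add_left' (((hF i).enorm.pow_const 2).const_mul _)]
    refine lintegral_mono fun ω => le_trans ?_ (sq_add_le_young hε _ _)
    gcongr
    rw [enorm_sub_rev]
    simpa using enorm_add_le (F i ω) (Y ω - F i ω)
  refine ge_of_tendsto' (x := l) ?_ h_le
  have h := (ENNReal.Tendsto.const_mul (a := 1 + (ε : ℝ≥0∞)) hBC (Or.inr (by simp))).add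
    (ENNReal.Tendsto.const_mul (a := 1 + (ε : ℝ≥0∞)⁻¹) h_lim (Or.inr (by simp [hε.ne'])))
  simpa only [mul_zero, add_zero] using h

theorem tendsto_lintegral_enorm_sq_sum_smul_sub [NormedSpace ℂ E] {ι A : Type*} {l : Filter A}
    (S : Finset ι) (c : ι → ℂ) {F : ι → A → Ω → E} {Y : ι → Ω → E}
    (hF : ∀ p i, AEStronglyMeasurable (F p i) P) (hY : ∀ p, AEStronglyMeasurable (Y p) P)
    (h_lim : ∀ p, Tendsto (fun i => ∫⁻ ω, ‖F p i ω - Y p ω‖ₑ ^ 2 ∂P) l (𝓝 0)) :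
    Tendsto (fun i => ∫⁻ ω, ‖(∑ p ∈ S, c p • F p i ω) - ∑ p ∈ S, c p • Y p ω‖ₑ ^ 2 ∂P) l
      (𝓝 0) := by
  have h_le (i) : ∫⁻ ω, ‖(∑ p ∈ S, c p • F p i ω) - ∑ p ∈ S, c p • Y p ω‖ₑ ^ 2 ∂P ≤
      S.card * ∑ p ∈ S, ‖c p‖ₑ ^ 2 * ∫⁻ ω, ‖F p i ω - Y p ω‖ₑ ^ 2 ∂P := by
    have h_meas (p) : AEMeasurable (fun ω => ‖F p i ω - Y p ω‖ₑ ^ 2) P :=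
      ((hF p i).sub (hY p)).enorm.pow_const 2
    simp only [← lintegral_const_mul'' _ (h_meas _)]
    rw [← lintegral_finsetSum' _ fun p _ => (h_meas p).const_mul _,
      ← lintegral_const_mul' _ _ (by simp)]
    refine lintegral_mono fun ω => ?_
    simp only [← Finset.sum_sub_distrib, ← smul_sub, ← mul_pow, ← enorm_smul]
    simp only [enorm_eq_nnnorm]
    norm_cast
    exact (pow_le_pow_left₀ zero_le (nnnorm_sum_le _ _) 2).trans sq_sum_le_card_mul_sum_sq
  refine tendsto_of_tendsto_of_tendsto_of_le_of_le tendsto_const_nhds ?_ (fun _ => bot_le) h_le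
  have h := ENNReal.Tendsto.const_mul (a := (S.card : ℝ≥0∞)) (tendsto_finsetSum S fun p _ =>
    ENNReal.Tendsto.const_mul (a := ‖c p‖ₑ ^ 2) (h_lim p) (Or.inr (by finiteness)))
    (Or.inr (by simp))
  simpa only [mul_zero, Finset.sum_const_zero] using h

theorem lintegral_lintegral_enorm_sq_le {A : Type*} [MeasurableSpace A] {μ : Measure A}
    [SFinite P] {X Φ : A → Ω → E} {G : A → Ω → ℝ≥0∞} (hG : Measurable (Function.uncurry G))
    (hΦ : ∀ᵐ r ∂μ, ∀ᵐ ω ∂P, ‖Φ r ω‖ₑ ^ 2 ≤ G r ω) {ε : ℝ≥0} (hε : 0 < ε) :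
    ∫⁻ r, ∫⁻ ω, ‖X r ω‖ₑ ^ 2 ∂P ∂μ ≤ (1 + ε) * ∫⁻ r, ∫⁻ ω, G r ω ∂P ∂μ +
      (1 + (ε : ℝ≥0∞)⁻¹) * ∫⁻ r, ∫⁻ ω, ‖X r ω - Φ r ω‖ₑ ^ 2 ∂P ∂μ := by
  have h_coe : (1 + (ε : ℝ≥0∞)) ≠ ∞ := by simp
  have h_inv : (1 + (ε : ℝ≥0∞)⁻¹) ≠ ∞ := by simp [hε.ne']
  have hG_int : Measurable fun r => ∫⁻ ω, G r ω ∂P := hG.lintegral_prod_right'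
  rw [← lintegral_const_mul' _ _ h_coe, ← lintegral_const_mul' _ _ h_inv,
    ← lintegral_add_left (hG_int.const_mul _)]
  refine lintegral_mono_ae (hΦ.mono fun r hr => ?_)
  rw [← lintegral_const_mul' _ _ h_coe, ← lintegral_const_mul' _ _ h_inv,
    ← lintegral_add_left ((hG.of_uncurry_left (x := r)).const_mul _)]
  refine lintegral_mono_ae (hr.mono fun ω hω => ?_)
  calc ‖X r ω‖ₑ ^ 2 ≤ (‖Φ r ω‖ₑ + ‖X r ω - Φ r ω‖ₑ) ^ 2 := by
        gcongr
        simpa using enorm_add_le (Φ r ω) (X r ω - Φ r ω)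
    _ ≤ (1 + ε) * ‖Φ r ω‖ₑ ^ 2 + (1 + (ε : ℝ≥0∞)⁻¹) * ‖X r ω - Φ r ω‖ₑ ^ 2 :=
        sq_add_le_young hε _ _
    _ ≤ (1 + ε) * G r ω + (1 + (ε : ℝ≥0∞)⁻¹) * ‖X r ω - Φ r ω‖ₑ ^ 2 := by gcongr

end NormedAddCommGroup

namespace IsOrthogonalNoise

variable {ι : Type*} {W : ι → ℝ≥0 → Ω → ℂ} {E : Type*} [NormedAddCommGroup E]
  [InnerProductSpace ℂ E]

theorem stronglyMeasurable_integral (hW : IsOrthogonalNoise 𝓕 P W) (p : ι)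
    (X : SimpleProcess 𝓕 E) : StronglyMeasurable (X.integral (W p)) := by
  have h_meas (r) : StronglyMeasurable (W p r) := (hW.adapted p r).mono (𝓕.le r)
  exact Finset.stronglyMeasurable_fun_sum _ fun i _ =>
    ((h_meas _).sub (h_meas _)).smul ((X.ξ_meas i).mono (𝓕.le _))

theorem lintegral_enorm_sq_sum_ito_le [IsFiniteMeasure P] (hW : IsOrthogonalNoise 𝓕 P W)
    (S : Finset ι) (c : ι → ℂ) {s t : ℝ≥0} {Φ : ι → ℝ≥0 → Ω → E} {Y : ι → Ω → E}
    (hY : ∀ p, IsItoIntegral 𝓕 P (W p) s t (Φ p) (Y p)) {G : ι → ℝ → Ω → ℝ≥0∞}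
    (hG : ∀ p, Measurable (Function.uncurry (G p)))
    (hΦ : ∀ p, ∀ᵐ r ∂(volume.restrict (Set.Ioc (s : ℝ) t)), ∀ᵐ ω ∂P,
      ‖Φ p r.toNNReal ω‖ₑ ^ 2 ≤ G p r ω) :
    ∫⁻ ω, ‖∑ p ∈ S, c p • Y p ω‖ₑ ^ 2 ∂P ≤
      ∑ p ∈ S, 2 * ‖c p‖ₑ ^ 2 * ∫⁻ r in Set.Ioc (s : ℝ) t, ∫⁻ ω, G p r ω ∂P := by
  choose hY_meas X hX h_val h_int using hY
  have hX_meas (p m) : AEStronglyMeasurable ((X p m).integral (W p)) P :=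
    (hW.stronglyMeasurable_integral p _).aestronglyMeasurable
  refine le_of_forall_le_one_add_mul fun ε hε => ?_
  refine lintegral_enorm_sq_le_of_tendsto (l := atTop)
    (fun m => Finset.aestronglyMeasurable_fun_sum S fun p _ => (hX_meas p m).const_smul (c p))
    (tendsto_lintegral_enorm_sq_sum_smul_sub S c hX_meas hY_meas h_int)
    (fun m => (hW.lintegral_enorm_sq_sum_integral_le S c (fun p => X p m)
      fun p _ => hX p m).trans (Finset.sum_le_sum fun p _ => mul_le_mul_right
        (lintegral_lintegral_enorm_sq_le (hG p) (hΦ p) hε) _)) ?_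
  rw [Finset.mul_sum]
  refine tendsto_finsetSum S fun p _ => ?_
  have h := ENNReal.Tendsto.const_mul (a := 2 * ‖c p‖ₑ ^ 2)
    ((tendsto_const_nhds (x := (1 + (ε : ℝ≥0∞)) *
        ∫⁻ r in Set.Ioc (s : ℝ) t, ∫⁻ ω, G p r ω ∂P)).add
      (ENNReal.Tendsto.const_mul (a := 1 + (ε : ℝ≥0∞)⁻¹) (h_val p)
        (Or.inr (by simp [hε.ne'])))) (Or.inr (by finiteness))
  simpa only [mul_zero, add_zero, mul_left_comm] using h

end IsOrthogonalNoise

end ItoLimit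

section Noise

variable {Ω : Type*} [mΩ : MeasurableSpace Ω] {𝓕 : Filtration ℝ≥0 mΩ} {P : Measure Ω}

/-! ### Orthogonality of the Brownian noise -/

section BrownianIncrement

variable {B : ℝ≥0 → Ω → ℝ}

theorem memLp_brownian_increment (hB : IsBrownianReal B P) (s t : ℝ≥0) :
    MemLp (fun ω => B t ω - B s ω) 2 P := by
  have h_law := hB.toIsPreBrownianReal.hasLaw_sub t s
  have h_mem := memLp_id_gaussianReal' (μ := 0) (v := nndist (t : ℝ) s) 2 (by simp)
  have h_map : P.map (B t - B s) = gaussianReal 0 (nndist (t : ℝ) s) := h_law.map_eq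
  rw [← h_map] at h_mem
  exact (memLp_map_measure_iff aestronglyMeasurable_id h_law.aemeasurable).1 h_mem

theorem integral_brownian_increment (hB : IsBrownianReal B P) (s t : ℝ≥0) :
    ∫ ω, (B t ω - B s ω) ∂P = 0 :=
  (hB.toIsPreBrownianReal.hasLaw_sub t s).integral_eq.trans integral_id_gaussianReal

theorem integral_brownian_increment_sq (hB : IsBrownianReal B P) {s t : ℝ≥0} (hst : s ≤ t) :
    ∫ ω, (B t ω - B s ω) ^ 2 ∂P = t - s := by
  have h_law := hB.toIsPreBrownianReal.hasLaw_sub t s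
  have h_var := h_law.variance_eq
  rw [variance_id_gaussianReal, variance_of_integral_eq_zero h_law.aemeasurable
    (integral_brownian_increment hB s t)] at h_var
  have h_dist : (nndist (t : ℝ) s : ℝ) = t - s := by
    rw [coe_nndist, Real.dist_eq, abs_of_nonneg (sub_nonneg.2 (NNReal.coe_le_coe.2 hst))]
  exact h_var.trans h_dist

end BrownianIncrement

theorem integral_add_mul_I_mul_add_mul_I {x₁ y₁ x₂ y₂ : Ω → ℝ} (hx₁ : MemLp x₁ 2 P)
    (hy₁ : MemLp y₁ 2 P) (hx₂ : MemLp x₂ 2 P) (hy₂ : MemLp y₂ 2 P) :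
    ∫ ω, ((x₁ ω : ℂ) + y₁ ω * Complex.I) * ((x₂ ω : ℂ) + y₂ ω * Complex.I) ∂P =
      ((∫ ω, x₁ ω * x₂ ω ∂P : ℝ) - (∫ ω, y₁ ω * y₂ ω ∂P : ℝ) : ℂ) +
      ((∫ ω, x₁ ω * y₂ ω ∂P : ℝ) + (∫ ω, y₁ ω * x₂ ω ∂P : ℝ) : ℂ) * Complex.I := by
  have h_expand (ω) : ((x₁ ω : ℂ) + y₁ ω * Complex.I) * ((x₂ ω : ℂ) + y₂ ω * Complex.I) =
      ((x₁ ω * x₂ ω - y₁ ω * y₂ ω : ℝ) : ℂ) +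
      ((x₁ ω * y₂ ω + y₁ ω * x₂ ω : ℝ) : ℂ) * Complex.I := by
    push_cast
    linear_combination (y₁ ω : ℂ) * y₂ ω * Complex.I_mul_I
  have h_int {x y : Ω → ℝ} (hx : MemLp x 2 P) (hy : MemLp y 2 P) :
      Integrable (fun ω => x ω * y ω) P := hx.integrable_mul hy
  have h_re := (h_int hx₁ hx₂).sub (h_int hy₁ hy₂)
  have h_im := (h_int hx₁ hy₂).add (h_int hy₁ hx₂)
  simp only [h_expand]
  rw [integral_add h_re.ofReal (h_im.ofReal.mul_const _), integral_mul_const,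
    integral_complex_ofReal, integral_complex_ofReal, integral_sub (h_int hx₁ hx₂) (h_int hy₁ hy₂),
    integral_add (h_int hx₁ hy₂) (h_int hy₁ hx₂), Complex.ofReal_sub, Complex.ofReal_add]

theorem increment_eq_reIm {Ω' : Type*} (w : ℝ≥0 → Ω' → ℂ) (s t : ℝ≥0) (ω : Ω') :
    w t ω - w s ω = ((reIm w true t ω - reIm w true s ω : ℝ) : ℂ) +
      ((reIm w false t ω - reIm w false s ω : ℝ) : ℂ) * Complex.I := by
  apply Complex.ext <;> simp [reIm]

theorem conj_increment_eq_reIm {Ω' : Type*} (w : ℝ≥0 → Ω' → ℂ) (s t : ℝ≥0) (ω : Ω') :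
    conj (w t ω - w s ω) = ((reIm w true t ω - reIm w true s ω : ℝ) : ℂ) +
      ((-(reIm w false t ω - reIm w false s ω) : ℝ) : ℂ) * Complex.I := by
  apply Complex.ext
  · simp [reIm]
  · simp [reIm, neg_add_eq_sub]

theorem negFreq_injective {d : ℕ} : Function.Injective (negFreq (d := d)) := fun _ _ h =>
  Subtype.ext (neg_injective (congrArg Subtype.val h))

namespace IsNoise

variable {d : ℕ} {W : NonzeroFreq d → Fin (d - 1) → ℝ≥0 → Ω → ℂ}

theorem memLp_increment (hW : IsNoise 𝓕 P W) (k : NonzeroFreq d) (i : Fin (d - 1)) (s t : ℝ≥0) :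
    MemLp (fun ω => W k i t ω - W k i s ω) 2 P :=
  memLp_re_im_iff.1 ⟨memLp_brownian_increment (hW.brownian k i true) s t,
    memLp_brownian_increment (hW.brownian k i false) s t⟩

theorem integral_increment [IsFiniteMeasure P] (hW : IsNoise 𝓕 P W) (k : NonzeroFreq d)
    (i : Fin (d - 1)) (s t : ℝ≥0) : ∫ ω, (W k i t ω - W k i s ω) ∂P = 0 := by
  have h_int (b) : Integrable (fun ω => reIm (W k i) b t ω - reIm (W k i) b s ω) P :=
    (memLp_brownian_increment (hW.brownian k i b) s t).integrable one_le_two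
  simp only [increment_eq_reIm]
  rw [integral_add (h_int true).ofReal ((h_int false).ofReal.mul_const _), integral_mul_const,
    integral_complex_ofReal, integral_complex_ofReal,
    integral_brownian_increment (hW.brownian k i true),
    integral_brownian_increment (hW.brownian k i false), Complex.ofReal_zero, zero_mul, add_zero]

theorem integral_conj_increment_mul_self (hW : IsNoise 𝓕 P W) (k : NonzeroFreq d)
    (i : Fin (d - 1)) {s t : ℝ≥0} (hst : s ≤ t) :
    ∫ ω, conj (W k i t ω - W k i s ω) * (W k i t ω - W k i s ω) ∂P =
      (2 * ((t : ℝ) - s) : ℝ) := by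
  have h_int (b) : Integrable (fun ω => (reIm (W k i) b t ω - reIm (W k i) b s ω) ^ 2) P :=
    (memLp_brownian_increment (hW.brownian k i b) s t).integrable_sq
  have h_sq (ω) : conj (W k i t ω - W k i s ω) * (W k i t ω - W k i s ω) =
      (((reIm (W k i) true t ω - reIm (W k i) true s ω) ^ 2 +
        (reIm (W k i) false t ω - reIm (W k i) false s ω) ^ 2 : ℝ) : ℂ) := by
    rw [← Complex.normSq_eq_conj_mul_self, Complex.normSq_apply, sq, sq]
    simp only [reIm, Complex.sub_re, Complex.sub_im, if_true, Bool.false_eq_true, if_false]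
  simp only [h_sq]
  rw [integral_complex_ofReal, integral_add (h_int true) (h_int false),
    integral_brownian_increment_sq (hW.brownian k i true) hst,
    integral_brownian_increment_sq (hW.brownian k i false) hst, two_mul]

theorem increment_ae_eq_conj (hW : IsNoise 𝓕 P W) (k : NonzeroFreq d) (i : Fin (d - 1))
    (s t : ℝ≥0) : ∀ᵐ ω ∂P, W k i t ω - W k i s ω =
      conj (W (negFreq k) i t ω - W (negFreq k) i s ω) := by
  filter_upwards [hW.conj_symm k i] with ω hω
  rw [hω, hω, map_sub, Complex.conj_conj, Complex.conj_conj]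

section HalfSpace

variable {S : Set (NonzeroFreq d)} {k l : NonzeroFreq d}

theorem integral_reIm_mul (hW : IsNoise 𝓕 P W)
    (hS : iIndepFun (fun (p : S × Fin (d - 1) × Bool) (ω : Ω) (t : ℝ≥0) =>
      reIm (W p.1.1 p.2.1) p.2.2 t ω) P) (hk : k ∈ S) (hl : l ∈ S) {i j : Fin (d - 1)}
    {b b' : Bool} (hne : (k, i, b) ≠ (l, j, b')) (s t : ℝ≥0) :
    ∫ ω, (reIm (W k i) b t ω - reIm (W k i) b s ω) *
      (reIm (W l j) b' t ω - reIm (W l j) b' s ω) ∂P = 0 := by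
  have h_meas : Measurable fun x : ℝ≥0 → ℝ => x t - x s :=
    (measurable_pi_apply t).sub (measurable_pi_apply s)
  have hpq : ((⟨k, hk⟩, i, b) : S × Fin (d - 1) × Bool) ≠ (⟨l, hl⟩, j, b') := fun h =>
    hne (congrArg (fun p : S × Fin (d - 1) × Bool => (p.1.1, p.2)) h)
  have h_mul := ((hS.indepFun hpq).comp h_meas h_meas).integral_fun_mul_eq_mul_integral
    (memLp_brownian_increment (hW.brownian k i b) s t).1
    (memLp_brownian_increment (hW.brownian l j b') s t).1
  refine h_mul.trans ?_
  simp only [Function.comp_apply, integral_brownian_increment (hW.brownian k i b), zero_mul]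

theorem integral_mul_of_mem (hW : IsNoise 𝓕 P W)
    (hS : iIndepFun (fun (p : S × Fin (d - 1) × Bool) (ω : Ω) (t : ℝ≥0) =>
      reIm (W p.1.1 p.2.1) p.2.2 t ω) P) (hk : k ∈ S) (hl : l ∈ S) (i j : Fin (d - 1))
    {s t : ℝ≥0} (hst : s ≤ t) :
    ∫ ω, (W k i t ω - W k i s ω) * (W l j t ω - W l j s ω) ∂P = 0 := by
  have h_mem (k i b) := memLp_brownian_increment (hW.brownian k i b) s t
  simp only [increment_eq_reIm]
  rw [integral_add_mul_I_mul_add_mul_I (h_mem k i true) (h_mem k i false) (h_mem l j true)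
    (h_mem l j false), hW.integral_reIm_mul hS hk hl (b := true) (b' := false) (by simp),
    hW.integral_reIm_mul hS hk hl (b := false) (b' := true) (by simp), Complex.ofReal_zero,
    add_zero, zero_mul, add_zero]
  by_cases hkl : (k, i) = (l, j)
  · obtain ⟨rfl, rfl⟩ := Prod.mk.inj hkl
    simp only [← sq, integral_brownian_increment_sq (hW.brownian k i _) hst, sub_self]
  · have hne (b : Bool) : (k, i, b) ≠ (l, j, b) := fun h => hkl (by grind)
    rw [hW.integral_reIm_mul hS hk hl (hne true), hW.integral_reIm_mul hS hk hl (hne false),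
      sub_self]

theorem integral_conj_mul_of_mem (hW : IsNoise 𝓕 P W)
    (hS : iIndepFun (fun (p : S × Fin (d - 1) × Bool) (ω : Ω) (t : ℝ≥0) =>
      reIm (W p.1.1 p.2.1) p.2.2 t ω) P) (hk : k ∈ S) (hl : l ∈ S) {i j : Fin (d - 1)}
    (hne : (k, i) ≠ (l, j)) (s t : ℝ≥0) :
    ∫ ω, conj (W k i t ω - W k i s ω) * (W l j t ω - W l j s ω) ∂P = 0 := by
  have h_mem (k i b) := memLp_brownian_increment (hW.brownian k i b) s t
  have h_zero (b b') := hW.integral_reIm_mul hS hk hl (i := i) (j := j) (b := b) (b' := b')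
    (fun h => hne (by grind)) s t
  simp only [conj_increment_eq_reIm, increment_eq_reIm (W l j)]
  refine (integral_add_mul_I_mul_add_mul_I (h_mem k i true) (h_mem k i false).neg (h_mem l j true)
    (h_mem l j false)).trans ?_
  simp only [Pi.neg_apply, neg_mul, integral_neg, h_zero, neg_zero, Complex.ofReal_zero, sub_zero,
    add_zero, zero_mul]

end HalfSpace

theorem integral_conj_mul_of_ne (hW : IsNoise 𝓕 P W) {k l : NonzeroFreq d} {i j : Fin (d - 1)}
    (hne : (k, i) ≠ (l, j)) {s t : ℝ≥0} (hst : s ≤ t) :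
    ∫ ω, conj (W k i t ω - W k i s ω) * (W l j t ω - W l j s ω) ∂P = 0 := by
  obtain ⟨S, h_half, hS⟩ := hW.indep_modes
  have h_neg_mem (k) (hk : k ∉ S) : negFreq k ∈ S := not_not.1 (mt (h_half k).2 hk)
  by_cases hk : k ∈ S <;> by_cases hl : l ∈ S
  · exact hW.integral_conj_mul_of_mem hS hk hl hne s t
  · have h_zero := congrArg conj (hW.integral_mul_of_mem hS hk (h_neg_mem l hl) i j hst)
    rw [← integral_conj, map_zero] at h_zero
    rw [← h_zero]
    refine integral_congr_ae ((hW.increment_ae_eq_conj l j s t).mono fun ω hω => ?_)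
    simp only [hω, map_mul]
  · rw [← hW.integral_mul_of_mem hS (h_neg_mem k hk) hl i j hst]
    refine integral_congr_ae ((hW.increment_ae_eq_conj k i s t).mono fun ω hω => ?_)
    simp only [hω, Complex.conj_conj]
  · have hne' : (negFreq l, j) ≠ (negFreq k, i) := fun h =>
      hne (by grind [negFreq_injective (Prod.mk.inj h).1])
    rw [← hW.integral_conj_mul_of_mem hS (h_neg_mem l hl) (h_neg_mem k hk) hne' s t]
    refine integral_congr_ae ?_
    filter_upwards [hW.increment_ae_eq_conj k i s t, hW.increment_ae_eq_conj l j s t] with ω hk hl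
    rw [hk, hl, Complex.conj_conj, mul_comm]

theorem isOrthogonalNoise [IsFiniteMeasure P] (hW : IsNoise 𝓕 P W) :
    IsOrthogonalNoise 𝓕 P fun (p : NonzeroFreq d × Fin (d - 1)) => W p.1 p.2 where
  adapted p := hW.adapted p.1 p.2
  memLp p := hW.memLp_increment p.1 p.2
  mean p := hW.integral_increment p.1 p.2
  variance p _ _ hst := hW.integral_conj_increment_mul_self p.1 p.2 hst
  uncorrelated _ _ hpq _ _ hst := hW.integral_conj_mul_of_ne hpq hst
  indep_past := hW.indep_past

end IsNoise

end Noise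

section Modes

variable {d : ℕ}

/-! ### Energy injected by the noise -/

section ModeEnergy

variable {I : Type*} {v : I → EuclideanSpace ℝ (Fin d)}

theorem tsum_ofReal_inner_sq_le (hv : Orthonormal ℝ v) (l : Fin d → ℤ) :
    ∑' i, ENNReal.ofReal ((2 * Real.pi * inner ℝ (freqVec l) (v i)) ^ 2) ≤
      ENNReal.ofReal (laplaceEigenvalue l) := by
  rw [ENNReal.tsum_eq_iSup_sum]
  refine iSup_le fun S => ?_
  have h_bessel : ∑ i ∈ S, inner ℝ (freqVec l) (v i) ^ 2 ≤ freqSq l := by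
    have h_le := hv.sum_inner_products_le (s := S) (freqVec l)
    rw [norm_sq_freqVec] at h_le
    simpa only [real_inner_comm, Real.norm_eq_abs, sq_abs] using h_le
  rw [← ENNReal.ofReal_sum_of_nonneg fun _ _ => sq_nonneg _, laplaceEigenvalue]
  refine ENNReal.ofReal_le_ofReal ?_
  calc ∑ i ∈ S, (2 * Real.pi * inner ℝ (freqVec l) (v i)) ^ 2
      = 4 * Real.pi ^ 2 * ∑ i ∈ S, inner ℝ (freqVec l) (v i) ^ 2 := by
        rw [Finset.mul_sum]
        exact Finset.sum_congr rfl fun i _ => by ring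
    _ ≤ 4 * Real.pi ^ 2 * freqSq l := by gcongr

theorem tsum_transportEnergy_le (hv : Orthonormal ℝ v) (k : Fin d → ℤ) (u : VectorField d)
    (l : Fin d → ℤ) : ∑' i, transportEnergy k (v i) u l ≤
      ENNReal.ofReal (laplaceEigenvalue l) * ‖fourierVec u (l - k)‖ₑ ^ 2 := by
  simp only [transportEnergy, ENNReal.tsum_mul_right]
  gcongr
  exact tsum_ofReal_inner_sq_le hv l

theorem tsum_transportEnergy_le_of_perp (hv : Orthonormal ℝ v) {k : Fin d → ℤ}
    (hk : ∀ i, inner ℝ (freqVec k) (v i) = 0) (u : VectorField d) (l : Fin d → ℤ) :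
    ∑' i, transportEnergy k (v i) u l ≤
      ENNReal.ofReal (laplaceEigenvalue (l - k)) * ‖fourierVec u (l - k)‖ₑ ^ 2 := by
  have h_inner (i) : inner ℝ (freqVec l) (v i) = inner ℝ (freqVec (l - k)) (v i) := by
    have h_sub : freqVec (l - k) = freqVec l - freqVec k := by
      ext j
      exact Int.cast_sub _ _
    rw [h_sub, inner_sub_left, hk, sub_zero]
  simp only [transportEnergy, ENNReal.tsum_mul_right, h_inner]
  gcongr
  exact tsum_ofReal_inner_sq_le hv (l - k)

/-- The energy which the noise `∑ θ_k a_{k,i} e_k` puts, through the transport term, into the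
`l`-th Fourier mode of `u`. -/
noncomputable def modeEnergy (θ : NonzeroFreq d → ℝ)
    (a : NonzeroFreq d → I → EuclideanSpace ℝ (Fin d)) (u : VectorField d) (l : Fin d → ℤ) :
    ℝ≥0∞ :=
  ∑' p : NonzeroFreq d × I, ENNReal.ofReal (θ p.1 ^ 2) * transportEnergy p.1.1 (a p.1 p.2) u l

variable {θ : NonzeroFreq d → ℝ} {a : NonzeroFreq d → I → EuclideanSpace ℝ (Fin d)}

theorem modeEnergy_eq_tsum (u : VectorField d) (l : Fin d → ℤ) :
    modeEnergy θ a u l = ∑' k : NonzeroFreq d, ENNReal.ofReal (θ k ^ 2) *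
      ∑' i, transportEnergy k.1 (a k i) u l := by
  rw [modeEnergy, ENNReal.tsum_prod']
  simp only [ENNReal.tsum_mul_left]

theorem modeEnergy_le (ha : ∀ k, Orthonormal ℝ (a k)) {T : ℝ} (hT : ∀ k, |θ k| ≤ T)
    (u : VectorField d) (l : Fin d → ℤ) :
    modeEnergy θ a u l ≤
      ENNReal.ofReal (T ^ 2) * ‖u‖ₑ ^ 2 * ENNReal.ofReal (laplaceEigenvalue l) := by
  have h_inj : Function.Injective fun k : NonzeroFreq d => l - k.1 :=
    (sub_right_injective (b := l)).comp Subtype.val_injective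
  calc modeEnergy θ a u l
      ≤ ∑' k : NonzeroFreq d, ENNReal.ofReal (T ^ 2) *
          (ENNReal.ofReal (laplaceEigenvalue l) * ‖fourierVec u (l - k.1)‖ₑ ^ 2) := by
        rw [modeEnergy_eq_tsum]
        exact ENNReal.tsum_le_tsum fun k => mul_le_mul'
          (ENNReal.ofReal_le_ofReal (sq_le_sq.2 ((hT k).trans (le_abs_self T))))
          (tsum_transportEnergy_le (ha k) k.1 u l)
    _ = ENNReal.ofReal (T ^ 2) * (ENNReal.ofReal (laplaceEigenvalue l) *
          ∑' k : NonzeroFreq d, ‖fourierVec u (l - k.1)‖ₑ ^ 2) := by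
        rw [ENNReal.tsum_mul_left, ENNReal.tsum_mul_left]
    _ ≤ ENNReal.ofReal (T ^ 2) * (ENNReal.ofReal (laplaceEigenvalue l) * ‖u‖ₑ ^ 2) := by
        rw [enorm_sq_eq_tsum_fourierVec u]
        gcongr
        exact ENNReal.tsum_comp_le_tsum_of_injective h_inj fun l => ‖fourierVec u l‖ₑ ^ 2
    _ = _ := by ring

theorem modeEnergy_zero (ha : ∀ k, Orthonormal ℝ (a k)) {T : ℝ} (hT : ∀ k, |θ k| ≤ T)
    (u : VectorField d) : modeEnergy θ a u 0 = 0 := by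
  have h_zero : laplaceEigenvalue (0 : Fin d → ℤ) = 0 := by simp [laplaceEigenvalue, freqSq]
  have h_mode := modeEnergy_le ha hT u 0
  rwa [h_zero, ENNReal.ofReal_zero, mul_zero, nonpos_iff_eq_zero] at h_mode

theorem tsum_modeEnergy_le (ha : ∀ k, Orthonormal ℝ (a k))
    (ha_perp : ∀ (k : NonzeroFreq d) i, inner ℝ (freqVec k.1) (a k i) = 0) {s : ℝ}
    (hθ : HasSum (fun k => θ k ^ 2) s) (u : VectorField d) :
    ∑' l, modeEnergy θ a u l ≤ ENNReal.ofReal s * gradNormSq u := by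
  have h_shift (k : NonzeroFreq d) : ∑' l, ENNReal.ofReal (laplaceEigenvalue (l - k.1)) *
      ‖fourierVec u (l - k.1)‖ₑ ^ 2 = gradNormSq u := by
    rw [gradNormSq_eq_tsum_fourierVec]
    exact (Equiv.subRight k.1).tsum_eq
      fun l => ENNReal.ofReal (laplaceEigenvalue l) * ‖fourierVec u l‖ₑ ^ 2
  calc ∑' l, modeEnergy θ a u l
      = ∑' k : NonzeroFreq d, ENNReal.ofReal (θ k ^ 2) *
          ∑' l, ∑' i, transportEnergy k.1 (a k i) u l := by
        simp only [modeEnergy_eq_tsum]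
        rw [ENNReal.tsum_comm]
        simp only [ENNReal.tsum_mul_left]
    _ ≤ ∑' k : NonzeroFreq d, ENNReal.ofReal (θ k ^ 2) * gradNormSq u := by
        gcongr with k
        rw [← h_shift k]
        exact ENNReal.tsum_le_tsum
          fun l => tsum_transportEnergy_le_of_perp (ha k) (ha_perp k) u l
    _ = ENNReal.ofReal s * gradNormSq u := by
        rw [ENNReal.tsum_mul_right, ← hθ.tsum_eq,
          ENNReal.ofReal_tsum_of_nonneg (fun _ => sq_nonneg _) hθ.summable]

end ModeEnergy

/-! ### Interpolation over the Fourier modes -/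

/-- The lattice sum `∑_{l ≠ 0} (4π²|l|²)^(-b)`; for `b ≠ 0` the term of index `l = 0` is the junk
value `0 ^ (-b) = 0`. -/
noncomputable def latticeSum (d : ℕ) (b : ℝ) : ℝ≥0∞ :=
  ∑' l : Fin d → ℤ, ENNReal.ofReal (laplaceEigenvalue l ^ (-b))

theorem exists_basis_freqVec_mem_span (d : ℕ) :
    ∃ B : Module.Basis (Fin d) ℝ (EuclideanSpace ℝ (Fin d)),
      ∀ l : Fin d → ℤ, freqVec l ∈ Submodule.span ℤ (Set.range B) :=
  ⟨(EuclideanSpace.basisFun (Fin d) ℝ).toBasis, fun l =>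
    ((EuclideanSpace.basisFun (Fin d) ℝ).toBasis.mem_span_iff_repr_mem ℤ _).2
      fun i => ⟨l i, by simp [freqVec]⟩⟩

theorem freqVec_injective : Function.Injective (freqVec (d := d)) := fun _ _ h =>
  funext fun j => Int.cast_injective (congrArg (fun x : EuclideanSpace ℝ (Fin d) => x j) h)

theorem summable_norm_freqVec_rpow {r : ℝ} (hr : r < -d) :
    Summable fun l : Fin d → ℤ => ‖freqVec l‖ ^ r := by
  obtain ⟨B, hB⟩ := exists_basis_freqVec_mem_span d
  have h_rank : Module.finrank ℤ (Submodule.span ℤ (Set.range B)) = d := by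
    rw [ZLattice.rank ℝ, finrank_euclideanSpace_fin]
  exact (ZLattice.summable_norm_rpow _ r (by rwa [h_rank])).comp_injective
    (i := fun l => (⟨freqVec l, hB l⟩ : Submodule.span ℤ (Set.range B)))
    fun _ _ h => freqVec_injective (congrArg Subtype.val h)

theorem latticeSum_ne_top {b : ℝ} (hb : (d : ℝ) / 2 < b) : latticeSum d b ≠ ∞ := by
  have h_rpow (l : Fin d → ℤ) : laplaceEigenvalue l ^ (-b) =
      (2 * Real.pi) ^ (-2 * b) * ‖freqVec l‖ ^ (-2 * b) := by
    have h_sq : laplaceEigenvalue l = (2 * Real.pi * ‖freqVec l‖) ^ (2 : ℝ) := by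
      rw [laplaceEigenvalue, ← norm_sq_freqVec, Real.rpow_two]
      ring
    rw [h_sq, ← Real.rpow_mul (by positivity), ← Real.mul_rpow (by positivity) (norm_nonneg _)]
    congr 1
    ring
  simp only [latticeSum, h_rpow]
  exact ((summable_norm_freqVec_rpow (by linarith)).mul_left _).tsum_ofReal_ne_top

theorem tsum_rpow_mul_le_rpow_mul_rpow {A : Type*} [Countable A] (c m : A → ℝ≥0∞) {p q : ℝ}
    (hp : 0 ≤ p) (hq : 0 ≤ q) (hpq : p + q = 1) :
    ∑' l, c l ^ q * m l ≤ (∑' l, m l) ^ p * (∑' l, c l * m l) ^ q := by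
  let _ : MeasurableSpace A := ⊤
  have h_holder := ENNReal.lintegral_mul_norm_pow_le (μ := Measure.count) (f := m)
    (g := fun l => c l * m l) (measurable_of_countable _).aemeasurable
    (measurable_of_countable _).aemeasurable hp hq hpq
  simp only [lintegral_count] at h_holder
  refine le_of_eq_of_le (tsum_congr fun l => ?_) h_holder
  rw [ENNReal.mul_rpow_of_nonneg _ _ hq, mul_left_comm, ← ENNReal.rpow_add_of_nonneg _ _ hp hq,
    hpq, ENNReal.rpow_one]

variable {I : Type*} {θ : NonzeroFreq d → ℝ}
  {a : NonzeroFreq d → I → EuclideanSpace ℝ (Fin d)}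

theorem tsum_rpow_neg_mul_modeEnergy_le (ha : ∀ k, Orthonormal ℝ (a k)) {T : ℝ}
    (hT : ∀ k, |θ k| ≤ T) (b : ℝ) (u : VectorField d) :
    ∑' l, ENNReal.ofReal (laplaceEigenvalue l ^ (-(b + 1))) * modeEnergy θ a u l ≤
      ENNReal.ofReal (T ^ 2) * latticeSum d b * ‖u‖ₑ ^ 2 := by
  rw [mul_right_comm, latticeSum, ← ENNReal.tsum_mul_left]
  refine ENNReal.tsum_le_tsum fun l => ?_
  rcases eq_or_ne l 0 with rfl | hl
  · rw [modeEnergy_zero ha hT, mul_zero]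
    exact zero_le
  · have h_pos := laplaceEigenvalue_pos hl
    refine (mul_le_mul_right (modeEnergy_le ha hT u l) _).trans_eq ?_
    rw [mul_left_comm, ← ENNReal.ofReal_mul (by positivity), ← Real.rpow_add_one h_pos.ne']
    ring_nf

theorem tsum_rpow_mul_modeEnergy_le (ha : ∀ k, Orthonormal ℝ (a k))
    (ha_perp : ∀ (k : NonzeroFreq d) i, inner ℝ (freqVec k.1) (a k i) = 0) {s T : ℝ}
    (hθ : HasSum (fun k => θ k ^ 2) s) (hT : ∀ k, |θ k| ≤ T) {p q : ℝ} (hp : 0 ≤ p) (hq : 0 ≤ q)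
    (hpq : p + q = 1) (b : ℝ) (u : VectorField d) :
    ∑' l, ENNReal.ofReal (laplaceEigenvalue l ^ (-(b + 1))) ^ q * modeEnergy θ a u l ≤
      (ENNReal.ofReal s * gradNormSq u) ^ p *
        (ENNReal.ofReal (T ^ 2) * latticeSum d b * ‖u‖ₑ ^ 2) ^ q := by
  refine (tsum_rpow_mul_le_rpow_mul_rpow _ _ hp hq hpq).trans ?_
  gcongr
  · exact tsum_modeEnergy_le ha ha_perp hθ u
  · exact tsum_rpow_neg_mul_modeEnergy_le ha hT b u

end Modes

/-! ### Smoothing in time -/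

theorem stronglyMeasurable_uncurry_of_isStronglyProgressive {Ω E : Type*} {mΩ : MeasurableSpace Ω}
    {𝓕 : Filtration ℝ≥0 mΩ} [TopologicalSpace E] [TopologicalSpace.PseudoMetrizableSpace E]
    {f : ℝ≥0 → Ω → E} (hf : IsStronglyProgressive 𝓕 f) :
    StronglyMeasurable (Function.uncurry f) := by
  have h_stopped (N : ℕ) : StronglyMeasurable fun q : ℝ≥0 × Ω => f (min q.1 N) q.2 := by
    have h_restrict : StronglyMeasurable fun q : Set.Iic (N : ℝ≥0) × Ω => f q.1 q.2 :=
      (hf N).mono (sup_le_sup le_rfl (MeasurableSpace.comap_mono (𝓕.le N)))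
    have h_min : Measurable fun q : ℝ≥0 × Ω =>
        ((⟨min q.1 N, Set.mem_Iic.2 (min_le_right _ _)⟩ : Set.Iic (N : ℝ≥0)), q.2) :=
      Measurable.prodMk (Measurable.subtype_mk (by fun_prop)) measurable_snd
    exact h_restrict.comp_measurable h_min
  refine stronglyMeasurable_of_tendsto atTop h_stopped (tendsto_pi_nhds.2 fun q => ?_)
  obtain ⟨M, hM⟩ := exists_nat_ge q.1
  refine tendsto_const_nhds.congr' ((eventually_ge_atTop M).mono fun N hN => ?_)
  change f q.1 q.2 = f (min q.1 N) q.2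
  rw [min_eq_left (hM.trans (Nat.cast_le.2 hN))]

theorem setLIntegral_Icc_setLIntegral_Ioc_swap {F : ℝ → ℝ → ℝ≥0∞}
    (hF : Measurable (Function.uncurry F)) (a b : ℝ) :
    ∫⁻ t in Set.Icc a b, ∫⁻ r in Set.Ioc a t, F t r =
      ∫⁻ r in Set.Ioc a b, ∫⁻ t in Set.Icc r b, F t r := by
  have h_meas : Measurable fun q : ℝ × ℝ => {q : ℝ × ℝ | q.2 ≤ q.1}.indicator
      (Function.uncurry F) q :=
    hF.indicator (measurableSet_le measurable_snd measurable_fst)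
  calc ∫⁻ t in Set.Icc a b, ∫⁻ r in Set.Ioc a t, F t r
      = ∫⁻ t in Set.Icc a b, ∫⁻ r in Set.Ioc a b,
          {q : ℝ × ℝ | q.2 ≤ q.1}.indicator (Function.uncurry F) (t, r) := by
        refine setLIntegral_congr_fun measurableSet_Icc fun t ht => ?_
        change _ = ∫⁻ r in Set.Ioc a b, (Set.Iic t).indicator (F t) r
        rw [setLIntegral_indicator measurableSet_Iic, Set.inter_comm, Set.Ioc_inter_Iic,
          min_eq_right ht.2]
    _ = ∫⁻ r in Set.Ioc a b, ∫⁻ t in Set.Icc a b,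
          {q : ℝ × ℝ | q.2 ≤ q.1}.indicator (Function.uncurry F) (t, r) :=
        lintegral_lintegral_swap h_meas.aemeasurable
    _ = ∫⁻ r in Set.Ioc a b, ∫⁻ t in Set.Icc r b, F t r := by
        refine setLIntegral_congr_fun measurableSet_Ioc fun r hr => ?_
        change ∫⁻ t in Set.Icc a b, (Set.Ici r).indicator (fun t => F t r) t = _
        have h_inter : Set.Ici r ∩ Set.Icc a b = Set.Icc r b := by
          rw [← Set.Ici_inter_Iic, ← Set.inter_assoc, Set.Ici_inter_Ici, sup_eq_left.2 hr.1.le,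
            Set.Ici_inter_Iic]
        rw [setLIntegral_indicator measurableSet_Ici, h_inter]

section ExponentialDecay

variable {c r b : ℝ}

theorem setLIntegral_exp_neg_le_one (hc : 0 ≤ c) (hb : b ≤ r + 1) :
    ∫⁻ t in Set.Icc r b, ENNReal.ofReal (Real.exp (-(2 * (c * (t - r))))) ≤ 1 := by
  calc ∫⁻ t in Set.Icc r b, ENNReal.ofReal (Real.exp (-(2 * (c * (t - r)))))
      ≤ ∫⁻ _ in Set.Icc r b, 1 := by
        refine setLIntegral_mono measurable_const fun t ht => ?_
        rw [← ENNReal.ofReal_one]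
        refine ENNReal.ofReal_le_ofReal (Real.exp_le_one_iff.2 (neg_nonpos.2 ?_))
        have := sub_nonneg.2 ht.1
        positivity
    _ = ENNReal.ofReal (b - r) := by rw [setLIntegral_one, Real.volume_Icc]
    _ ≤ 1 := ENNReal.ofReal_le_one.2 (by linarith)

theorem setLIntegral_exp_neg_le_inv (hc : 0 < c) :
    ∫⁻ t in Set.Icc r b, ENNReal.ofReal (Real.exp (-(2 * (c * (t - r))))) ≤
      ENNReal.ofReal c⁻¹ := by
  have h_neg : -(2 * c) < 0 := by linarith
  have h_exp (t : ℝ) : Real.exp (-(2 * (c * (t - r)))) =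
      Real.exp (2 * c * r) * Real.exp (-(2 * c) * t) := by
    rw [← Real.exp_add]
    ring_nf
  have h_integral : ∫ t in Set.Ioi r, Real.exp (-(2 * (c * (t - r)))) = (2 * c)⁻¹ := by
    simp only [h_exp]
    rw [integral_const_mul, integral_exp_mul_Ioi h_neg, neg_div_neg_eq, ← mul_div_assoc,
      ← Real.exp_add, neg_mul, add_neg_cancel, Real.exp_zero, one_div]
  calc ∫⁻ t in Set.Icc r b, ENNReal.ofReal (Real.exp (-(2 * (c * (t - r)))))
      ≤ ∫⁻ t in Set.Ici r, ENNReal.ofReal (Real.exp (-(2 * (c * (t - r))))) :=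
        lintegral_mono_set Set.Icc_subset_Ici_self
    _ = ENNReal.ofReal (2 * c)⁻¹ := by
        rw [setLIntegral_congr Ioi_ae_eq_Ici.symm, ← h_integral,
          ofReal_integral_eq_lintegral_ofReal _ (ae_of_all _ fun t => (Real.exp_pos _).le)]
        simp only [h_exp]
        exact (integrableOn_exp_mul_Ioi h_neg r).const_mul _
    _ ≤ ENNReal.ofReal c⁻¹ := ENNReal.ofReal_le_ofReal (inv_anti₀ hc (by linarith))

theorem setLIntegral_exp_neg_le_rpow (hc : 0 < c) (hb : b ≤ r + 1) {η : ℝ} (hη₀ : 0 ≤ η)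
    (hη₁ : η ≤ 1) :
    ∫⁻ t in Set.Icc r b, ENNReal.ofReal (Real.exp (-(2 * (c * (t - r))))) ≤
      ENNReal.ofReal (c ^ (-η)) := by
  rcases le_total c 1 with hc₁ | hc₁
  · refine (setLIntegral_exp_neg_le_one hc.le hb).trans ?_
    rw [← ENNReal.ofReal_one]
    exact ENNReal.ofReal_le_ofReal
      (Real.one_le_rpow_of_pos_of_le_one_of_nonpos hc hc₁ (neg_nonpos.2 hη₀))
  · refine (setLIntegral_exp_neg_le_inv hc).trans (ENNReal.ofReal_le_ofReal ?_)
    rw [← Real.rpow_neg_one]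
    exact Real.rpow_le_rpow_of_exponent_le hc₁ (neg_le_neg hη₁)

end ExponentialDecay

section SmoothedEnergy

variable {d : ℕ} {I : Type*} {θ : NonzeroFreq d → ℝ}
  {a : NonzeroFreq d → I → EuclideanSpace ℝ (Fin d)}

/-- The energy which the noise injects into `u`, damped mode by mode by the heat semigroup run for
a time `τ`. -/
noncomputable def smoothedEnergy (θ : NonzeroFreq d → ℝ)
    (a : NonzeroFreq d → I → EuclideanSpace ℝ (Fin d)) (τ : ℝ) (u : VectorField d) : ℝ≥0∞ :=
  ∑' l, ENNReal.ofReal (Real.exp (-(2 * (laplaceEigenvalue l * τ)))) * modeEnergy θ a u l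

theorem smoothedEnergy_eq_tsum (τ : ℝ) (u : VectorField d) :
    smoothedEnergy θ a τ u = ∑' p : NonzeroFreq d × I, ENNReal.ofReal (θ p.1 ^ 2) *
      ∑' l, ENNReal.ofReal (Real.exp (-(2 * (laplaceEigenvalue l * τ)))) *
        transportEnergy p.1.1 (a p.1 p.2) u l := by
  simp only [smoothedEnergy, modeEnergy, ← ENNReal.tsum_mul_left]
  rw [ENNReal.tsum_comm]
  simp only [mul_left_comm]

section Measurability

variable {A : Type*} [MeasurableSpace A] {g : A → VectorField d} {τ : A → ℝ}

theorem measurable_tsum_exp_mul_transportEnergy (hg : StronglyMeasurable g) (hτ : Measurable τ)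
    (k : Fin d → ℤ) (v : EuclideanSpace ℝ (Fin d)) :
    Measurable fun x => ∑' l, ENNReal.ofReal (Real.exp (-(2 * (laplaceEigenvalue l * τ x)))) *
      transportEnergy k v (g x) l := by
  refine Measurable.tsum fun l =>
    Measurable.mul ?_ ((measurable_enorm_sq_fourierVec_comp hg _).const_mul _)
  fun_prop

theorem measurable_smoothedEnergy [Countable I] (hg : StronglyMeasurable g) (hτ : Measurable τ) :
    Measurable fun x => smoothedEnergy θ a (τ x) (g x) := by
  simp only [smoothedEnergy_eq_tsum]
  exact Measurable.tsum fun p =>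
    (measurable_tsum_exp_mul_transportEnergy hg hτ p.1.1 (a p.1 p.2)).const_mul _

end Measurability

theorem setLIntegral_smoothedEnergy_le (ha : ∀ k, Orthonormal ℝ (a k))
    (ha_perp : ∀ (k : NonzeroFreq d) i, inner ℝ (freqVec k.1) (a k i) = 0) {s T : ℝ}
    (hθ : HasSum (fun k => θ k ^ 2) s) (hT : ∀ k, |θ k| ≤ T) {p q b δ : ℝ} (hp : 0 ≤ p)
    (hq : 0 ≤ q) (hpq : p + q = 1) (hb : 0 ≤ b + 1) (hqb : q * (b + 1) ≤ 1) (hδ : 0 < δ)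
    {r t₁ : ℝ} (ht₁ : t₁ ≤ r + 1) (u : VectorField d) :
    ∫⁻ t in Set.Icc r t₁, smoothedEnergy θ a (δ * (t - r)) u ≤
      ENNReal.ofReal (δ ^ (-(q * (b + 1)))) * ((ENNReal.ofReal s * gradNormSq u) ^ p *
        (ENNReal.ofReal (T ^ 2) * latticeSum d b * ‖u‖ₑ ^ 2) ^ q) := by
  have h_mode (l : Fin d → ℤ) : (∫⁻ t in Set.Icc r t₁,
      ENNReal.ofReal (Real.exp (-(2 * (laplaceEigenvalue l * (δ * (t - r))))))) *
        modeEnergy θ a u l ≤ ENNReal.ofReal (δ ^ (-(q * (b + 1)))) *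
        (ENNReal.ofReal (laplaceEigenvalue l ^ (-(b + 1))) ^ q * modeEnergy θ a u l) := by
    rcases eq_or_ne l 0 with rfl | hl
    · rw [modeEnergy_zero ha hT, mul_zero]
      exact zero_le
    have h_pos := laplaceEigenvalue_pos hl
    rw [← mul_assoc]
    gcongr
    simp only [← mul_assoc _ δ]
    refine (setLIntegral_exp_neg_le_rpow (mul_pos h_pos hδ) ht₁ (by positivity) hqb).trans_eq ?_
    rw [ENNReal.ofReal_rpow_of_pos (by positivity), ← Real.rpow_mul h_pos.le,
      ← ENNReal.ofReal_mul (by positivity), Real.mul_rpow h_pos.le hδ.le]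
    ring_nf
  simp only [smoothedEnergy]
  rw [lintegral_tsum fun l => by fun_prop]
  simp only [fun l => lintegral_mul_const (modeEnergy θ a u l) (μ := volume.restrict (Set.Icc r t₁))
    (f := fun t => ENNReal.ofReal (Real.exp (-(2 * (laplaceEigenvalue l * (δ * (t - r)))))))
    (by fun_prop)]
  refine (ENNReal.tsum_le_tsum h_mode).trans ?_
  rw [ENNReal.tsum_mul_left]
  gcongr
  exact tsum_rpow_mul_modeEnergy_le ha ha_perp hθ hT hp hq hpq b u

end SmoothedEnergy

/-! ### The stochastic convolution -/

theorem tsum_mul_lintegral_lintegral {ι A B : Type*} [Countable ι] [MeasurableSpace A]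
    [MeasurableSpace B] {μ : Measure A} {ρ : Measure B} [SFinite ρ] (w : ι → ℝ≥0∞)
    {G : ι → A → B → ℝ≥0∞} (hG : ∀ p, Measurable (Function.uncurry (G p))) :
    ∑' p, w p * ∫⁻ x, ∫⁻ y, G p x y ∂ρ ∂μ = ∫⁻ x, ∫⁻ y, ∑' p, w p * G p x y ∂ρ ∂μ := by
  have h_slice (p : ι) (x : A) : Measurable (G p x) := (hG p).comp measurable_prodMk_left
  have h_inner (p : ι) : Measurable fun x => ∫⁻ y, G p x y ∂ρ := (hG p).lintegral_prod_right'
  have h_tsum (x : A) : ∫⁻ y, ∑' p, w p * G p x y ∂ρ = ∑' p, w p * ∫⁻ y, G p x y ∂ρ := by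
    rw [lintegral_tsum fun p => ((h_slice p x).const_mul _).aemeasurable]
    exact tsum_congr fun p => lintegral_const_mul _ (h_slice p x)
  simp only [h_tsum]
  rw [lintegral_tsum fun p => ((h_inner p).const_mul _).aemeasurable]
  exact tsum_congr fun p => (lintegral_const_mul _ (h_inner p)).symm

theorem two_mul_enorm_sq_noiseCoeff_le {d : ℕ} (hd : 2 ≤ d) {κ : ℝ} (hκ : 0 ≤ κ) (x : ℝ) :
    2 * ‖((√((d : ℝ) / ((d : ℝ) - 1) * κ) * x : ℝ) : ℂ)‖ₑ ^ 2 ≤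
      ENNReal.ofReal (4 * κ) * ENNReal.ofReal (x ^ 2) := by
  have hd' : (2 : ℝ) ≤ d := Nat.ofNat_le_cast.2 hd
  have h_pos : 0 < (d : ℝ) - 1 := by linarith
  have h_ratio : (d : ℝ) / ((d : ℝ) - 1) ≤ 2 := by
    rw [div_le_iff₀ h_pos]
    linarith
  rw [enorm_sq_eq_ofReal, Complex.norm_real, Real.norm_eq_abs, sq_abs, mul_pow,
    Real.sq_sqrt (by positivity), ← ENNReal.ofReal_ofNat 2, ← ENNReal.ofReal_mul zero_le_two,
    ← ENNReal.ofReal_mul (by positivity)]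
  refine ENNReal.ofReal_le_ofReal ?_
  calc 2 * ((d : ℝ) / ((d : ℝ) - 1) * κ * x ^ 2) ≤ 2 * (2 * κ * x ^ 2) := by gcongr
    _ = 4 * κ * x ^ 2 := by ring

section StochConvolution

variable {Ω : Type*} [mΩ : MeasurableSpace Ω] {𝓕 : Filtration ℝ≥0 mΩ} {P : Measure Ω} {d : ℕ}
  {θ : NonzeroFreq d → ℝ} {f : ℝ≥0 → Ω → VectorField d}

theorem stronglyMeasurable_uncurry_toNNReal (hf : StronglyMeasurable (Function.uncurry f)) :
    StronglyMeasurable fun x : ℝ × Ω => f x.1.toNNReal x.2 :=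
  hf.comp_measurable ((measurable_real_toNNReal.comp measurable_fst).prodMk measurable_snd)

theorem measurable_gradNormSq_path (hf : StronglyMeasurable (Function.uncurry f)) (ω : Ω) :
    Measurable fun r : ℝ => gradNormSq (f r.toNNReal ω) :=
  measurable_gradNormSq_comp
    ((stronglyMeasurable_uncurry_toNNReal hf).comp_measurable (measurable_prodMk_right (y := ω)))

variable {a : NonzeroFreq d → Fin (d - 1) → EuclideanSpace ℝ (Fin d)}
  {W : NonzeroFreq d → Fin (d - 1) → ℝ≥0 → Ω → ℂ} {κ δ : ℝ}

theorem lintegral_enorm_sq_stochConvolution_le [IsFiniteMeasure P] (hd : 2 ≤ d) (hκ : 0 ≤ κ)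
    (hW : IsOrthogonalNoise 𝓕 P fun p : NonzeroFreq d × Fin (d - 1) => W p.1 p.2)
    (ha_perp : ∀ (k : NonzeroFreq d) i, inner ℝ (freqVec k.1) (a k i) = 0)
    (hf : StronglyMeasurable (Function.uncurry f)) {s t : ℝ≥0}
    (h_fin : ∀ᵐ r ∂(volume.restrict (Set.Ioc (s : ℝ) t)), ∀ᵐ ω ∂P,
      gradNormSq (f r.toNNReal ω) ≠ ∞)
    {Z : Ω → VectorField d} (hZ : IsStochConvolution 𝓕 P κ δ θ a W f s t Z) :
    ∫⁻ ω, ‖Z ω‖ₑ ^ 2 ∂P ≤ ENNReal.ofReal (4 * κ) * ∫⁻ r in Set.Ioc (s : ℝ) t, ∫⁻ ω,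
      smoothedEnergy θ a (δ * (t - r)) (f r.toNNReal ω) ∂P := by
  obtain ⟨-, Y, hY, h_lim⟩ := hZ
  let G (p : NonzeroFreq d × Fin (d - 1)) (r : ℝ) (ω : Ω) : ℝ≥0∞ :=
    ∑' l, ENNReal.ofReal (Real.exp (-(2 * (laplaceEigenvalue l * (δ * (t - r)))))) *
      transportEnergy p.1.1 (a p.1 p.2) (f r.toNNReal ω) l
  have hG (p) : Measurable (Function.uncurry (G p)) :=
    measurable_tsum_exp_mul_transportEnergy (τ := fun x : ℝ × Ω => δ * (t - x.1))
      (stronglyMeasurable_uncurry_toNNReal hf) (by fun_prop) _ _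
  have h_integrand (p : NonzeroFreq d × Fin (d - 1)) :
      ∀ᵐ r ∂(volume.restrict (Set.Ioc (s : ℝ) t)), ∀ᵐ ω ∂P,
        ‖heat (δ * ((t : ℝ) - r.toNNReal))
          (helmholtz (transport p.1.1 (a p.1 p.2) (f r.toNNReal ω)))‖ₑ ^ 2 ≤ G p r ω := by
    filter_upwards [h_fin, ae_restrict_mem measurableSet_Ioc] with r hr hr_mem
    filter_upwards [hr] with ω hω
    rw [Real.coe_toNNReal r (s.2.trans hr_mem.1.le)]
    exact enorm_sq_heat_helmholtz_transport_le hω (ha_perp p.1 p.2) _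
  let c (p : NonzeroFreq d × Fin (d - 1)) : ℂ := (√((d : ℝ) / ((d : ℝ) - 1) * κ) * θ p.1 : ℝ)
  have h_sum : ∫⁻ ω, ‖Z ω‖ₑ ^ 2 ∂P ≤
      ∑' p, 2 * ‖c p‖ₑ ^ 2 * ∫⁻ r in Set.Ioc (s : ℝ) t, ∫⁻ ω, G p r ω ∂P :=
    lintegral_enorm_sq_le_of_tendsto
      (fun S => Finset.aestronglyMeasurable_fun_sum S fun p _ => (hY p).1.const_smul (c p)) h_lim
      (fun S => hW.lintegral_enorm_sq_sum_ito_le S c hY hG h_integrand) ENNReal.summable.hasSum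
  calc ∫⁻ ω, ‖Z ω‖ₑ ^ 2 ∂P ≤ ∑' p : NonzeroFreq d × Fin (d - 1), ENNReal.ofReal (4 * κ) *
        (ENNReal.ofReal (θ p.1 ^ 2) * ∫⁻ r in Set.Ioc (s : ℝ) t, ∫⁻ ω, G p r ω ∂P) := by
        refine h_sum.trans (ENNReal.tsum_le_tsum fun p => ?_)
        rw [← mul_assoc]
        exact mul_le_mul_left (two_mul_enorm_sq_noiseCoeff_le hd hκ (θ p.1)) _
    _ = _ := by
        rw [ENNReal.tsum_mul_left, tsum_mul_lintegral_lintegral _ hG]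
        simp only [smoothedEnergy_eq_tsum, G]

end StochConvolution

/-! ### The energy estimate -/

theorem lintegral_rpow_mul_rpow_le {A : Type*} [MeasurableSpace A] {μ : Measure A}
    [IsProbabilityMeasure μ] {g F : A → ℝ≥0∞} {x y : ℝ≥0∞} {p q : ℝ} (hp : 0 ≤ p) (hq : 0 ≤ q)
    (hpq : p + q = 1) (hg : AEMeasurable g μ) (hg_le : ∫⁻ r, g r ∂μ ≤ x)
    (hF : ∀ᵐ r ∂μ, F r ≤ y) : ∫⁻ r, g r ^ p * F r ^ q ∂μ ≤ x ^ p * y ^ q :=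
  calc ∫⁻ r, g r ^ p * F r ^ q ∂μ ≤ ∫⁻ r, g r ^ p * y ^ q ∂μ :=
        lintegral_mono_ae (hF.mono fun r hr => by gcongr)
    _ ≤ (∫⁻ r, g r ∂μ) ^ p * (∫⁻ _, y ∂μ) ^ q :=
        ENNReal.lintegral_mul_norm_pow_le hg aemeasurable_const hp hq hpq
    _ ≤ x ^ p * y ^ q := by
        rw [lintegral_const, measure_univ, mul_one]
        gcongr

section EnergyEstimate

variable {Ω : Type*} [MeasurableSpace Ω] {P : Measure Ω} {d : ℕ}
  {f : ℝ≥0 → Ω → VectorField d} {ν : ℝ}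

namespace EnergyInequality

theorem enorm_sq_le (hE : EnergyInequality P ν f) :
    ∀ᵐ ω ∂P, ∀ s t : ℝ≥0, s < t → ‖f t ω‖ₑ ^ 2 ≤ ‖f s ω‖ₑ ^ 2 :=
  hE.mono fun _ hω s t hst => le_self_add.trans (hω s t hst)

theorem lintegral_gradNormSq_le (hE : EnergyInequality P ν f) (hν : 0 < ν) :
    ∀ᵐ ω ∂P, ∀ s t : ℝ≥0, s < t → ∫⁻ r in Set.Ioc (s : ℝ) t, gradNormSq (f r.toNNReal ω) ≤
      ENNReal.ofReal ν⁻¹ * ‖f s ω‖ₑ ^ 2 := by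
  filter_upwards [hE] with ω hω s t hst
  rw [ENNReal.ofReal_inv_of_pos hν, ← ENNReal.mul_le_iff_le_inv (ENNReal.ofReal_pos.2 hν).ne'
    ENNReal.ofReal_ne_top]
  exact le_add_self.trans (hω s t hst)

theorem ae_gradNormSq_ne_top [SFinite P] (hE : EnergyInequality P ν f) (hν : 0 < ν)
    (hf : StronglyMeasurable (Function.uncurry f)) {s t : ℝ≥0} (hst : s < t) :
    ∀ᵐ r ∂(volume.restrict (Set.Ioc (s : ℝ) t)), ∀ᵐ ω ∂P, gradNormSq (f r.toNNReal ω) ≠ ∞ := by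
  have h_meas := measurable_gradNormSq_comp (stronglyMeasurable_uncurry_toNNReal hf)
  have h_set : MeasurableSet {x : ℝ × Ω | gradNormSq (f x.1.toNNReal x.2) ≠ ∞} :=
    h_meas (measurableSet_singleton ∞).compl
  rw [Measure.ae_ae_comm h_set]
  filter_upwards [hE.lintegral_gradNormSq_le hν] with ω hω
  have h_int : ∫⁻ r in Set.Ioc (s : ℝ) t, gradNormSq (f r.toNNReal ω) ≠ ∞ :=
    ne_top_of_le_ne_top (by finiteness) (hω s t hst)
  exact (ae_lt_top (measurable_gradNormSq_path hf ω) h_int).mono fun r hr => hr.ne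

theorem lintegral_interpolation_le (hE : EnergyInequality P ν f) (hν : 0 < ν)
    (hf : StronglyMeasurable (Function.uncurry f)) {p q : ℝ} (hp : 0 ≤ p) (hq : 0 ≤ q)
    (hpq : p + q = 1) (n : ℝ≥0) (x y : ℝ≥0∞) :
    ∀ᵐ ω ∂P, ∫⁻ r in Set.Ioc (n : ℝ) (n + 1), (x * gradNormSq (f r.toNNReal ω)) ^ p *
      (y * ‖f r.toNNReal ω‖ₑ ^ 2) ^ q ≤ (x * ENNReal.ofReal ν⁻¹) ^ p * y ^ q * ‖f n ω‖ₑ ^ 2 := by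
  have h_prob : IsProbabilityMeasure (volume.restrict (Set.Ioc (n : ℝ) (n + 1))) :=
    ⟨by rw [Measure.restrict_apply_univ, Real.volume_Ioc, add_sub_cancel_left, ENNReal.ofReal_one]⟩
  filter_upwards [hE.enorm_sq_le, hE.lintegral_gradNormSq_le hν] with ω h_decay h_dissipation
  have h_meas := measurable_gradNormSq_path hf ω
  have h_unit := h_dissipation n (n + 1) (lt_add_one n)
  push_cast at h_unit
  calc ∫⁻ r in Set.Ioc (n : ℝ) (n + 1), (x * gradNormSq (f r.toNNReal ω)) ^ p *
        (y * ‖f r.toNNReal ω‖ₑ ^ 2) ^ q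
      ≤ (x * (ENNReal.ofReal ν⁻¹ * ‖f n ω‖ₑ ^ 2)) ^ p * (y * ‖f n ω‖ₑ ^ 2) ^ q := by
        refine lintegral_rpow_mul_rpow_le hp hq hpq (h_meas.const_mul _).aemeasurable ?_ ?_
        · rw [lintegral_const_mul _ h_meas]
          gcongr
        · filter_upwards [ae_restrict_mem measurableSet_Ioc] with r hr
          have h_lt : n < r.toNNReal := Real.lt_toNNReal_iff_coe_lt.2 hr.1
          exact mul_le_mul_right (h_decay n _ h_lt) y
    _ = (x * ENNReal.ofReal ν⁻¹) ^ p * y ^ q * ‖f n ω‖ₑ ^ 2 := by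
        rw [← mul_assoc, ENNReal.mul_rpow_of_nonneg _ (_ ^ 2) hp,
          ENNReal.mul_rpow_of_nonneg _ (_ ^ 2) hq, mul_mul_mul_comm,
          ← ENNReal.rpow_add_of_nonneg _ _ hp hq, hpq, ENNReal.rpow_one]

end EnergyInequality

variable {I : Type*} {θ : NonzeroFreq d → ℝ}
  {a : NonzeroFreq d → I → EuclideanSpace ℝ (Fin d)} {δ s T p q b : ℝ}

theorem lintegral_lintegral_smoothedEnergy_le [SFinite P] (hδ : 0 < δ) (hν : 0 < ν)
    (ha : ∀ k, Orthonormal ℝ (a k))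
    (ha_perp : ∀ (k : NonzeroFreq d) i, inner ℝ (freqVec k.1) (a k i) = 0)
    (hθ : HasSum (fun k => θ k ^ 2) s) (hT : ∀ k, |θ k| ≤ T)
    (hf : StronglyMeasurable (Function.uncurry f)) (hE : EnergyInequality P ν f) (hp : 0 ≤ p)
    (hq : 0 ≤ q) (hpq : p + q = 1) (hb : 0 ≤ b + 1) (hqb : q * (b + 1) ≤ 1) (n : ℝ≥0) :
    ∫⁻ r in Set.Ioc (n : ℝ) (n + 1), ∫⁻ ω, (∫⁻ t in Set.Icc r (n + 1),
        smoothedEnergy θ a (δ * (t - r)) (f r.toNNReal ω)) ∂P ≤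
      ENNReal.ofReal (δ ^ (-(q * (b + 1)))) * ((ENNReal.ofReal s * ENNReal.ofReal ν⁻¹) ^ p *
        (ENNReal.ofReal (T ^ 2) * latticeSum d b) ^ q * ∫⁻ ω, ‖f n ω‖ₑ ^ 2 ∂P) := by
  have h_grad := measurable_gradNormSq_comp (stronglyMeasurable_uncurry_toNNReal hf)
  have h_norm : Measurable fun x : ℝ × Ω => ‖f x.1.toNNReal x.2‖ₑ :=
    (stronglyMeasurable_uncurry_toNNReal hf).enorm
  let H (r : ℝ) (ω : Ω) : ℝ≥0∞ := (ENNReal.ofReal s * gradNormSq (f r.toNNReal ω)) ^ p *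
    (ENNReal.ofReal (T ^ 2) * latticeSum d b * ‖f r.toNNReal ω‖ₑ ^ 2) ^ q
  have hH : Measurable (Function.uncurry H) :=
    ((h_grad.const_mul _).pow_const p).mul (((h_norm.pow_const 2).const_mul _).pow_const q)
  have h_meas_init : AEMeasurable (fun ω => ‖f n ω‖ₑ ^ 2) P :=
    ((hf.comp_measurable measurable_prodMk_left).enorm.pow_const 2).aemeasurable
  calc ∫⁻ r in Set.Ioc (n : ℝ) (n + 1), ∫⁻ ω, (∫⁻ t in Set.Icc r (n + 1),
        smoothedEnergy θ a (δ * (t - r)) (f r.toNNReal ω)) ∂P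
      ≤ ∫⁻ r in Set.Ioc (n : ℝ) (n + 1), ∫⁻ ω, ENNReal.ofReal (δ ^ (-(q * (b + 1)))) * H r ω ∂P :=
        setLIntegral_mono' measurableSet_Ioc fun r hr => lintegral_mono fun ω =>
          setLIntegral_smoothedEnergy_le ha ha_perp hθ hT hp hq hpq hb hqb hδ
            (by linarith [hr.1]) _
    _ = ENNReal.ofReal (δ ^ (-(q * (b + 1)))) *
          ∫⁻ ω, (∫⁻ r in Set.Ioc (n : ℝ) (n + 1), H r ω) ∂P := by
        simp only [lintegral_const_mul' _ _ ENNReal.ofReal_ne_top]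
        rw [lintegral_lintegral_swap hH.aemeasurable]
    _ ≤ _ := by
        rw [← lintegral_const_mul'' _ h_meas_init]
        exact mul_le_mul_right
          (lintegral_mono_ae (hE.lintegral_interpolation_le hν hf hp hq hpq n _ _)) _

end EnergyEstimate

section Conclusion

variable {Ω : Type*} [mΩ : MeasurableSpace Ω] {𝓕 : Filtration ℝ≥0 mΩ} {P : Measure Ω} {d : ℕ}
  {f : ℝ≥0 → Ω → VectorField d} {θ : NonzeroFreq d → ℝ}
  {a : NonzeroFreq d → Fin (d - 1) → EuclideanSpace ℝ (Fin d)}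
  {W : NonzeroFreq d → Fin (d - 1) → ℝ≥0 → Ω → ℂ} {κ ν δ : ℝ} {n : ℝ≥0}
  {Z : ℝ≥0 → Ω → VectorField d}

theorem lintegral_enorm_sq_stochConvolution_toNNReal_le [IsFiniteMeasure P] (hd : 2 ≤ d)
    (hκ : 0 ≤ κ) (hν : 0 < ν)
    (hW : IsOrthogonalNoise 𝓕 P fun p : NonzeroFreq d × Fin (d - 1) => W p.1 p.2)
    (ha_perp : ∀ (k : NonzeroFreq d) i, inner ℝ (freqVec k.1) (a k i) = 0)
    (hf : StronglyMeasurable (Function.uncurry f)) (hE : EnergyInequality P ν f)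
    (hZ : ∀ t ∈ Set.Icc n (n + 1), IsStochConvolution 𝓕 P κ δ θ a W f n t (Z t)) {t : ℝ}
    (ht : t ∈ Set.Icc (n : ℝ) (n + 1)) :
    ∫⁻ ω, ‖Z t.toNNReal ω‖ₑ ^ 2 ∂P ≤ ENNReal.ofReal (4 * κ) * ∫⁻ r in Set.Ioc (n : ℝ) t, ∫⁻ ω,
      smoothedEnergy θ a (δ * (t - r)) (f r.toNNReal ω) ∂P := by
  lift t to ℝ≥0 using n.2.trans ht.1
  have ht' : t ∈ Set.Icc n (n + 1) := by exact_mod_cast ht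
  rw [Real.toNNReal_coe]
  refine lintegral_enorm_sq_stochConvolution_le hd hκ hW ha_perp hf ?_ (hZ t ht')
  exact ae_restrict_of_ae_restrict_of_subset (Set.Ioc_subset_Ioc_right ht'.2)
    (hE.ae_gradNormSq_ne_top hν hf (lt_add_one n))

theorem measurable_lintegral_smoothedEnergy [SFinite P] {I : Type*} [Countable I]
    {a : NonzeroFreq d → I → EuclideanSpace ℝ (Fin d)}
    (hf : StronglyMeasurable (Function.uncurry f)) :
    Measurable (Function.uncurry fun t r : ℝ =>
      ∫⁻ ω, smoothedEnergy θ a (δ * (t - r)) (f r.toNNReal ω) ∂P) :=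
  Measurable.lintegral_prod_right' (f := fun x : (ℝ × ℝ) × Ω =>
    smoothedEnergy θ a (δ * (x.1.1 - x.1.2)) (f x.1.2.toNNReal x.2)) <|
    measurable_smoothedEnergy ((stronglyMeasurable_uncurry_toNNReal hf).comp_measurable
      (measurable_fst.snd.prodMk measurable_snd)) (by fun_prop)

theorem lintegral_swap_smoothedEnergy [SFinite P] {I : Type*} [Countable I]
    {a : NonzeroFreq d → I → EuclideanSpace ℝ (Fin d)}
    (hf : StronglyMeasurable (Function.uncurry f)) (r : ℝ) (S : Set ℝ) :
    ∫⁻ t in S, (∫⁻ ω, smoothedEnergy θ a (δ * (t - r)) (f r.toNNReal ω) ∂P) =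
      ∫⁻ ω, (∫⁻ t in S, smoothedEnergy θ a (δ * (t - r)) (f r.toNNReal ω)) ∂P :=
  lintegral_lintegral_swap <| Measurable.aemeasurable <|
    measurable_smoothedEnergy (g := fun x : ℝ × Ω => f r.toNNReal x.2)
      (τ := fun x : ℝ × Ω => δ * (x.1 - r))
      (hf.comp_measurable (measurable_const.prodMk measurable_snd)) (by fun_prop)

theorem lintegral_lintegral_enorm_sq_stochConvolution_le [IsFiniteMeasure P] (hd : 2 ≤ d)
    (hκ : 0 ≤ κ) (hν : 0 < ν) (hδ : 0 < δ)
    (hW : IsOrthogonalNoise 𝓕 P fun p : NonzeroFreq d × Fin (d - 1) => W p.1 p.2)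
    (ha : ∀ k, Orthonormal ℝ (a k))
    (ha_perp : ∀ (k : NonzeroFreq d) i, inner ℝ (freqVec k.1) (a k i) = 0) {s T p q b : ℝ}
    (hθ : HasSum (fun k => θ k ^ 2) s) (hT : ∀ k, |θ k| ≤ T)
    (hf : StronglyMeasurable (Function.uncurry f)) (hE : EnergyInequality P ν f) (hp : 0 ≤ p)
    (hq : 0 ≤ q) (hpq : p + q = 1) (hb : 0 ≤ b + 1) (hqb : q * (b + 1) ≤ 1)
    (hZ : ∀ t ∈ Set.Icc n (n + 1), IsStochConvolution 𝓕 P κ δ θ a W f n t (Z t)) :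
    ∫⁻ t in Set.Icc (n : ℝ) (n + 1), ∫⁻ ω, ‖Z t.toNNReal ω‖ₑ ^ 2 ∂P ≤
      ENNReal.ofReal (4 * κ) * (ENNReal.ofReal (δ ^ (-(q * (b + 1)))) *
        ((ENNReal.ofReal s * ENNReal.ofReal ν⁻¹) ^ p *
          (ENNReal.ofReal (T ^ 2) * latticeSum d b) ^ q * ∫⁻ ω, ‖f n ω‖ₑ ^ 2 ∂P)) :=
  calc ∫⁻ t in Set.Icc (n : ℝ) (n + 1), ∫⁻ ω, ‖Z t.toNNReal ω‖ₑ ^ 2 ∂P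
      ≤ ∫⁻ t in Set.Icc (n : ℝ) (n + 1), ENNReal.ofReal (4 * κ) * ∫⁻ r in Set.Ioc (n : ℝ) t,
          ∫⁻ ω, smoothedEnergy θ a (δ * (t - r)) (f r.toNNReal ω) ∂P :=
        setLIntegral_mono' measurableSet_Icc fun t ht =>
          lintegral_enorm_sq_stochConvolution_toNNReal_le hd hκ hν hW ha_perp hf hE hZ ht
    _ = ENNReal.ofReal (4 * κ) * ∫⁻ r in Set.Ioc (n : ℝ) (n + 1), ∫⁻ ω,
          (∫⁻ t in Set.Icc r (n + 1), smoothedEnergy θ a (δ * (t - r)) (f r.toNNReal ω)) ∂P := by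
        rw [lintegral_const_mul' _ _ ENNReal.ofReal_ne_top, setLIntegral_Icc_setLIntegral_Ioc_swap
          (measurable_lintegral_smoothedEnergy hf)]
        simp only [lintegral_swap_smoothedEnergy hf]
    _ ≤ _ := mul_le_mul_right (lintegral_lintegral_smoothedEnergy_le hδ hν ha ha_perp hθ hT hf hE
        hp hq hpq hb hqb n) _

end Conclusion

theorem abs_le_iSup_abs_of_hasSum_sq {ι : Type*} {x : ι → ℝ} {s : ℝ}
    (hx : HasSum (fun k => x k ^ 2) s) (k : ι) : |x k| ≤ ⨆ j, |x j| := by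
  refine le_ciSup (f := fun j => |x j|) ⟨√s, ?_⟩ k
  rintro _ ⟨j, rfl⟩
  exact Real.abs_le_sqrt (le_hasSum hx j fun i _ => sq_nonneg (x i))

theorem exists_pos_forall_nat_lt_le (K : ℕ → ℝ) (x : ℝ) :
    ∃ C, 0 < C ∧ ∀ d : ℕ, (d : ℝ) < x → K d ≤ C := by
  obtain ⟨M, hM⟩ := ((Finset.range ⌈x⌉₊).finite_toSet.image K).bddAbove
  refine ⟨max M 1, lt_max_of_lt_right one_pos, fun d hd => le_max_of_le_left (hM ?_)⟩
  exact Set.mem_image_of_mem K (Finset.mem_coe.2 (Finset.mem_range.2 (Nat.lt_ceil.2 hd)))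

theorem ofReal_interpolation_constant_eq {κ ν δ s T p q c : ℝ} (hκ : 0 < κ) (hν : 0 < ν)
    (hδ : 0 < δ) (hs : 0 ≤ s) (hT : 0 ≤ T) (hp : 0 ≤ p) (hq : 0 ≤ q) {L : ℝ≥0∞} (hL : L ≠ ∞) :
    ENNReal.ofReal (4 * κ) * (ENNReal.ofReal (δ ^ c) *
        ((ENNReal.ofReal s * ENNReal.ofReal ν⁻¹) ^ p * (ENNReal.ofReal (T ^ 2) * L) ^ q)) =
      ENNReal.ofReal (4 * L.toReal ^ q * κ * s ^ p * ν ^ (-p) * δ ^ c * T ^ (2 * q)) := by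
  lift L to ℝ≥0 using hL
  rw [← ENNReal.ofReal_coe_nnreal (p := L), ← ENNReal.ofReal_mul hs,
    ← ENNReal.ofReal_mul (by positivity), ENNReal.ofReal_rpow_of_nonneg (by positivity) hp,
    ENNReal.ofReal_rpow_of_nonneg (by positivity) hq, ← ENNReal.ofReal_mul (by positivity),
    ← ENNReal.ofReal_mul (by positivity), ← ENNReal.ofReal_mul (by positivity),
    Real.mul_rpow hs (by positivity), Real.mul_rpow (sq_nonneg T) L.coe_nonneg, Real.inv_rpow hν.le,
    ← Real.rpow_neg hν.le, ← Real.rpow_natCast_mul hT, ENNReal.toReal_ofReal L.coe_nonneg]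
  push_cast
  ring_nf

end TransportNoise

theorem theorem3p4_general (α β : ℝ) (hα₀ : 0 < α) (hα₁ : α ≤ 1) :
    ∃ C : ℝ, 0 < C ∧
      ∀ (d : ℕ), 1 ≤ (d : ℝ) / 2 → (d : ℝ) / 2 < β →
      ∀ (κ ν δ : ℝ), 0 < κ → 0 < ν → 0 < δ →
      ∀ (θ : TransportNoise.NonzeroFreq d → ℝ) (s : ℝ), HasSum (fun k => θ k ^ 2) s →
      ∀ (a : TransportNoise.NonzeroFreq d → Fin (d - 1) → EuclideanSpace ℝ (Fin d)),
        (∀ k, Orthonormal ℝ (a k)) →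
        (∀ (k : TransportNoise.NonzeroFreq d) i,
          inner ℝ (TransportNoise.freqVec k.1) (a k i) = 0) →
      ∀ (Ω : Type*) [mΩ : MeasurableSpace Ω] (P : Measure Ω) [IsFiniteMeasure P]
        (𝓕 : Filtration ℝ≥0 mΩ)
        (W : TransportNoise.NonzeroFreq d → Fin (d - 1) → ℝ≥0 → Ω → ℂ),
        TransportNoise.IsOrthogonalNoise 𝓕 P
          (fun p : TransportNoise.NonzeroFreq d × Fin (d - 1) => W p.1 p.2) →
      ∀ (f : ℝ≥0 → Ω → TransportNoise.VectorField d),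
        StronglyMeasurable (Function.uncurry f) →
        TransportNoise.EnergyInequality P ν f →
      ∀ (n : ℝ≥0) (Z : ℝ≥0 → Ω → TransportNoise.VectorField d),
        (∀ t ∈ Set.Icc n (n + 1),
          TransportNoise.IsStochConvolution 𝓕 P κ δ θ a W f n t (Z t)) →
        ∫⁻ t in Set.Icc (n : ℝ) (n + 1), ∫⁻ ω, ‖Z t.toNNReal ω‖ₑ ^ 2 ∂P ≤
          ENNReal.ofReal (C * κ * s ^ (β / (α + β)) * ν ^ (-(β / (α + β)))
              * δ ^ (-(α * (2 * β + d + 4) / (4 * (α + β))))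
              * (⨆ k, |θ k|) ^ (2 * α / (α + β)))
            * ∫⁻ ω, ‖f n ω‖ₑ ^ 2 ∂P := by
  obtain ⟨C, hC, h_const⟩ := TransportNoise.exists_pos_forall_nat_lt_le
    (fun d => 4 * (TransportNoise.latticeSum d ((2 * β + d) / 4)).toReal ^ (α / (α + β))) (2 * β)
  refine ⟨C, hC, fun d hd hdβ κ ν δ hκ hν hδ θ s hθ a ha ha_perp Ω _ P _ 𝓕 W hW f hf hE n Z hZ =>
    ?_⟩
  have hβ : 0 < β := by linarith
  have hαβ : 0 < α + β := by linarith
  have hs : 0 ≤ s := hθ.nonneg fun k => sq_nonneg _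
  have h_sup : 0 ≤ ⨆ k, |θ k| := Real.iSup_nonneg fun k => abs_nonneg _
  have h_smoothing : α / (α + β) * ((2 * β + d) / 4 + 1) ≤ 1 := by
    rw [div_mul_eq_mul_div, div_le_one hαβ]
    nlinarith
  have h_exponent : α / (α + β) * ((2 * β + d) / 4 + 1) =
      α * (2 * β + d + 4) / (4 * (α + β)) := by
    field_simp
  refine (TransportNoise.lintegral_lintegral_enorm_sq_stochConvolution_le
    (p := β / (α + β)) (by exact_mod_cast (by linarith : (2 : ℝ) ≤ d)) hκ.le hν hδ hW ha ha_perp hθ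
    (TransportNoise.abs_le_iSup_abs_of_hasSum_sq hθ) hf hE (by positivity) (by positivity)
    (by field_simp; ring) (by positivity) h_smoothing hZ).trans ?_
  simp only [← mul_assoc _ _ (∫⁻ ω, ‖f n ω‖ₑ ^ 2 ∂P)]
  rw [TransportNoise.ofReal_interpolation_constant_eq hκ hν hδ hs h_sup (by positivity)
    (by positivity) (TransportNoise.latticeSum_ne_top (by linarith)), h_exponent,
    ← mul_div_assoc 2 α]
  have h_le := h_const d (by linarith)
  gcongr

theorem theorem3p4 (α β : ℝ) (hα₀ : 0 < α) (hα₁ : α < 1) :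
    ∃ C : ℝ, 0 < C ∧
      ∀ (d : ℕ), 1 ≤ (d : ℝ) / 2 → (d : ℝ) / 2 < β →
      ∀ (κ ν δ : ℝ), 0 < κ → 0 < ν → 0 < δ →
      ∀ (θ : TransportNoise.NonzeroFreq d → ℝ), TransportNoise.IsNoiseCoeff θ →
      ∀ (a : TransportNoise.NonzeroFreq d → Fin (d - 1) → EuclideanSpace ℝ (Fin d)),
        TransportNoise.IsNoiseFrame a →
      ∀ (Ω : Type*) [mΩ : MeasurableSpace Ω] (P : Measure Ω) [IsProbabilityMeasure P]
        (𝓕 : Filtration ℝ≥0 mΩ)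
        (W : TransportNoise.NonzeroFreq d → Fin (d - 1) → ℝ≥0 → Ω → ℂ),
        TransportNoise.IsNoise 𝓕 P W →
      ∀ (f : ℝ≥0 → Ω → TransportNoise.VectorField d),
        IsStronglyProgressive 𝓕 f →
        (∀ t ω, TransportNoise.IsRealField (f t ω) ∧ TransportNoise.HasZeroMean (f t ω)) →
        TransportNoise.EnergyInequality P ν f →
      ∀ (n : ℝ≥0) (Z : ℝ≥0 → Ω → TransportNoise.VectorField d),
        (∀ t ∈ Set.Icc n (n + 1),
          TransportNoise.IsStochConvolution 𝓕 P κ δ θ a W f n t (Z t)) →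
        ∫⁻ t in Set.Icc (n : ℝ) (n + 1), ∫⁻ ω, ‖Z t.toNNReal ω‖ₑ ^ 2 ∂P ≤
          ENNReal.ofReal (C * κ * ν ^ (-(β / (α + β)))
              * δ ^ (-(α * (2 * β + d + 4) / (4 * (α + β))))
              * (⨆ k, |θ k|) ^ (2 * α / (α + β)))
            * ∫⁻ ω, ‖f n ω‖ₑ ^ 2 ∂P := by
  obtain ⟨C, hC, h_bound⟩ := theorem3p4_general α β hα₀ hα₁.le
  refine ⟨C, hC, fun d hd hdβ κ ν δ hκ hν hδ θ hθ a ha Ω _ P _ 𝓕 W hW f hf _ hE n Z hZ => ?_⟩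
  simpa only [Real.one_rpow, mul_one] using h_bound d hd hdβ κ ν δ hκ hν hδ θ 1 hθ.norm_one a
    ha.orthonormal ha.perp Ω P 𝓕 W hW.isOrthogonalNoise f
    (TransportNoise.stronglyMeasurable_uncurry_of_isStronglyProgressive hf) hE n Z hZ
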